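/- **Setting.** Let $d\ge 0$ be an integer and let $\mathcal P(\mathbb R^d)$ be the set of probability densities on $\mathbb R^d$ (with respect to Lebesgue measure) that are twice continuously differentiable, everywhere positive, and have finite second moment. Let $\mathcal H_k$ be a real reproducing kernel Hilbert space on $\mathbb R^d$ whose kernel $k$ is symmetric, strictly positive definite and continuous, and let $\mathcal H_k^d$ be its $d$-fold Hilbert sum, a space of vector fields. For a density $\rho$ with $\int k(x,x)\rho(x)\,dx<\infty$ let $\iota_{k,\rho}:\mathcal H_k^d\to L_2^d(\rho)$ be the inclusion and $\iota_{k,\rho}^*$ its adjoint. The operator $\iota_{k,\rho}\iota_{k,\rho}^*$ on $L_2^d(\rho)$ is compact, positive and self-adjoint, and its powers are defined spectrally. For $\rho,\pi\in\mathcal P(\mathbb R^d)$ and $\gamma\in(0,\tfrac12]$ let $\|\mathfrak I(\rho,\gamma)\|_{L_2^d(\rho)}\in[0,\infty]$ be the norm of the pre-image $\mathfrak I(\rho,\gamma)=(\iota_{k,\rho}\iota_{k,\rho}^*)^{-\gamma}\nabla\log\frac{\rho}{\pi}$, that is, the least norm of an $h\in L_2^d(\rho)$ with $(\iota_{k,\rho}\iota_{k,\rho}^*)^{\gamma}h=\nabla\log\frac{\rho}{\pi}$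 ($\rho$-a.e.), and $\infty$ if there is no such $h$. For continuously differentiable densities write $I(\rho|\pi)=\int|\nabla\log\frac{\rho}{\pi}|^2\rho\,dx\in[0,\infty]$ for the Fisher information, and $\mathrm{KL}(\rho|\pi)\in[0,\infty]$ for the Kullback–Leibler divergence. Fix $\nu\in(0,1)$ and $\pi\in\mathcal P(\mathbb R^d)$. A solution of the regularized Stein variational gradient flow (R-SVGF) $$\partial_t\rho_t=\nabla\cdot(\rho_t v_t),\qquad v_t=\iota_{k,\rho_t}\big((1-\nu)\iota_{k,\rho_t}^*\iota_{k,\rho_t}+\nu I_d\big)^{-1}\iota_{k,\rho_t}^*\Big(\nabla\log\frac{\rho_t}{\pi}\Big)$$ ($I_d$ the identity of $\mathcal H_k^d$) is a family $(\rho_t)_{t\ge0}$ in $\mathcal P(\mathbb R^d)$ such that $\rho_t(x)$ and $\nabla\rho_t(x)$ are continuous in $(t,x)\in[0,\infty)\times\mathbb R^d$; for every $t>0$, $\int k(x,x)\rho_t(x)\,dx<\infty$ and $\nabla\log\frac{\rho_t}{\pi}\in L_2^d(\rho_t)$, so that $v_t$ is defined; $(t,x)\mapsto v_t(x)$ is measurable,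 with $\int_0^T\!\int|v_t|\rho_t\,dx\,dt<\infty$ for every $T>0$; and the equation holds weakly: for every $\phi\in C_c^\infty(\mathbb R\times\mathbb R^d)$, $$\int_0^\infty\!\!\int_{\mathbb R^d}\big(\partial_t\phi(t,x)-\nabla\phi(t,x)\cdot v_t(x)\big)\rho_t(x)\,dx\,dt+\int_{\mathbb R^d}\phi(0,x)\rho_0(x)\,dx=0 .$$ **Theorem.** Let $(\rho_t)_{t\ge0}$ be a solution of the R-SVGF, and suppose that for every $t>0$ a number $\gamma_t\in(0,\tfrac12]$ is given with $\|\mathfrak I(\rho_t,\gamma_t)\|_{L_2^d(\rho_t)}<\infty$ (equivalently, $\nabla\log\frac{\rho_t}{\pi}$ lies in the range of $(\iota_{k,\rho_t}\iota_{k,\rho_t}^*)^{\gamma_t}$). Then $$\int_0^\infty I(\rho_t|\pi)\,dt\le(1-\nu)\,\mathrm{KL}(\rho_0|\pi)+\int_0^\infty\nu^{2\gamma_t}(1-\nu)^{-2\gamma_t}\|\mathfrak I(\rho_t,\gamma_t)\|_{L_2^d(\rho_t)}^2\,dt$$ (as an inequality in $[0,\infty]$). Furthermore, if $\mathrm{KL}(\rho_0|\pi)<\infty$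 and the last integral is finite, then $I(\bar\rho_t|\pi)\to0$ as $t\to\infty$, where $\bar\rho_t=\frac1t\int_0^t\rho_s\,ds$. -/

import Mathlib

open MeasureTheory Set Filter Topology
open scoped ENNReal RealInnerProductSpace ContDiff

/-! ### Probability densities on `ℝ^d` -/

/-- The class `𝒫(ℝ^d)`: probability densities with respect to Lebesgue measure that are twice
continuously differentiable, everywhere positive and have a finite second moment. -/
structure IsSmoothDensity {d : ℕ} (ρ : EuclideanSpace ℝ (Fin d) → ℝ) : Prop where
  contDiff : ContDiff ℝ 2 ρ
  pos : ∀ x, 0 < ρ x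
  integrable : Integrable ρ
  integral_eq_one : ∫ x, ρ x = 1
  second_moment : Integrable (fun x => ‖x‖ ^ 2 * ρ x)

/-- The measure `ρ(x) dx`. -/
noncomputable def densityMeasure {d : ℕ} (ρ : EuclideanSpace ℝ (Fin d) → ℝ) :
    Measure (EuclideanSpace ℝ (Fin d)) :=
  volume.withDensity (fun x => ENNReal.ofReal (ρ x))

/-- The vector field `∇ log (ρ / π)`. -/
noncomputable def score {d : ℕ} (ρ π : EuclideanSpace ℝ (Fin d) → ℝ) :
    EuclideanSpace ℝ (Fin d) → EuclideanSpace ℝ (Fin d) :=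
  gradient (fun y => Real.log (ρ y / π y))

/-- The relative Fisher information `I(ρ|π) = ∫ |∇ log (ρ / π)|² ρ dx`, with values in
`[0, ∞]`. -/
noncomputable def fisherInfo {d : ℕ} (ρ π : EuclideanSpace ℝ (Fin d) → ℝ) : ℝ≥0∞ :=
  ∫⁻ x, ‖score ρ π x‖ₑ ^ 2 ∂(densityMeasure ρ)

/-- The averaged density `(1/t) ∫₀ᵗ ρ_s ds`. -/
noncomputable def avgDensity {d : ℕ} (ρ : ℝ → EuclideanSpace ℝ (Fin d) → ℝ) (t : ℝ) :
    EuclideanSpace ℝ (Fin d) → ℝ :=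
  fun x => t⁻¹ * ∫ s in (0 : ℝ)..t, ρ s x

/-! ### The reproducing kernel Hilbert space and its inclusion into `L₂` -/

/-- The scalar reproducing kernel `k(x, y)` of a Hilbert space `H` of functions `ℝ^d → ℝ`. -/
noncomputable def scalarKernel {d : ℕ} (H : Type*) [NormedAddCommGroup H] [InnerProductSpace ℝ H]
    [CompleteSpace H] [RKHS ℝ H (EuclideanSpace ℝ (Fin d)) ℝ] (x y : EuclideanSpace ℝ (Fin d)) :
    ℝ :=
  RKHS.kernel H x y 1

/-- A symmetric, strictly positive definite and continuous kernel: for finitely many distinct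
points `x_i` and coefficients `c_i` that are not all zero, `∑ c_i c_j k(x_i, x_j) > 0`. -/
structure IsContinuousSPDKernel {X : Type*} [TopologicalSpace X] (k : X → X → ℝ) : Prop where
  posDef : (Matrix.of k).PosDef
  continuous : Continuous (Function.uncurry k)

section Inclusion

variable {d : ℕ} {H : Type*} [NormedAddCommGroup H] [InnerProductSpace ℝ H]
  [CompleteSpace H] [RKHS ℝ H (EuclideanSpace ℝ (Fin d)) ℝ]

/-- An element `f = (f₁, …, f_d)` of `H_k^d` as a vector field on `ℝ^d`. The Hilbert space `H_k^d`
is `PiLp 2 (fun _ : Fin d => H)`, whose norm is `(∑ ‖f_i‖²)^{1/2}`. -/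
noncomputable def vectorField (f : PiLp 2 (fun _ : Fin d => H)) :
    EuclideanSpace ℝ (Fin d) → EuclideanSpace ℝ (Fin d) :=
  fun x => WithLp.toLp 2 (fun i => f i x)

theorem scalarKernel_eq_inner (x y : EuclideanSpace ℝ (Fin d)) :
    scalarKernel H x y = ⟪RKHS.kerFun H x 1, RKHS.kerFun H y 1⟫ := by
  have h := RKHS.kernel_inner (𝕜 := ℝ) (H := H) x y 1 1
  simp only [RCLike.inner_apply, conj_trivial, one_mul] at h
  rw [scalarKernel, h, real_inner_comm]

theorem scalarKernel_self (x : EuclideanSpace ℝ (Fin d)) :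
    scalarKernel H x x = ‖RKHS.kerFun H x 1‖ ^ 2 := by
  rw [scalarKernel_eq_inner, real_inner_self_eq_norm_sq]

theorem rkhs_apply_eq_inner (f : H) (x : EuclideanSpace ℝ (Fin d)) :
    f x = ⟪RKHS.kerFun H x 1, f⟫ := by
  simp

theorem continuous_rkhs_apply
    (hk : Continuous (Function.uncurry (scalarKernel (d := d) H))) (f : H) :
    Continuous (fun x : EuclideanSpace ℝ (Fin d) => f x) := by
  have hK : Continuous (fun x : EuclideanSpace ℝ (Fin d) => RKHS.kerFun H x (1 : ℝ)) := by
    rw [continuous_iff_continuousAt]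
    intro x₀
    rw [ContinuousAt, tendsto_iff_norm_sub_tendsto_zero]
    have h1 : Continuous fun x : EuclideanSpace ℝ (Fin d) =>
        Real.sqrt (scalarKernel H x x - 2 * scalarKernel H x x₀ + scalarKernel H x₀ x₀) :=
      (((hk.comp (continuous_id.prodMk continuous_id)).sub
        ((hk.comp (continuous_id.prodMk continuous_const)).const_mul 2)).add_const _).sqrt
    have h2 : ∀ x, Real.sqrt (scalarKernel H x x - 2 * scalarKernel H x x₀ +
        scalarKernel H x₀ x₀) = ‖RKHS.kerFun H x (1 : ℝ) - RKHS.kerFun H x₀ 1‖ := fun x => by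
      rw [scalarKernel_self x, scalarKernel_self x₀, scalarKernel_eq_inner x x₀,
        ← norm_sub_sq_real, Real.sqrt_sq (norm_nonneg _)]
    have h3 := h1.tendsto x₀
    rw [h2 x₀, sub_self, norm_zero] at h3
    exact h3.congr h2
  exact (hK.inner (𝕜 := ℝ) (continuous_const (y := f))).congr
    fun x => (rkhs_apply_eq_inner f x).symm

theorem norm_vectorField_sq_le (f : PiLp 2 (fun _ : Fin d => H)) (x : EuclideanSpace ℝ (Fin d)) :
    ‖vectorField f x‖ ^ 2 ≤ ‖f‖ ^ 2 * scalarKernel H x x := by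
  rw [EuclideanSpace.norm_sq_eq, PiLp.norm_sq_eq_of_L2, Finset.sum_mul]
  refine Finset.sum_le_sum fun i _ => ?_
  rw [scalarKernel_self, ← mul_pow]
  refine pow_le_pow_left₀ (norm_nonneg _) ?_ 2
  have h : vectorField f x i = ⟪RKHS.kerFun H x 1, f i⟫ := by
    rw [← rkhs_apply_eq_inner]; rfl
  rw [h, mul_comm]
  exact norm_inner_le_norm _ _

theorem continuous_vectorField
    (hk : Continuous (Function.uncurry (scalarKernel (d := d) H)))
    (f : PiLp 2 (fun _ : Fin d => H)) : Continuous (vectorField f) :=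
  (PiLp.continuous_toLp 2 _).comp (continuous_pi fun i => continuous_rkhs_apply hk (f i))

theorem memLp_vectorField
    (hk : Continuous (Function.uncurry (scalarKernel (d := d) H)))
    {μ : Measure (EuclideanSpace ℝ (Fin d))}
    (hμ : Integrable (fun x => scalarKernel H x x) μ)
    (f : PiLp 2 (fun _ : Fin d => H)) : MemLp (vectorField f) 2 μ := by
  have hm : AEStronglyMeasurable (vectorField f) μ :=
    (continuous_vectorField hk f).aestronglyMeasurable
  rw [memLp_two_iff_integrable_sq_norm hm]
  refine (hμ.const_mul (‖f‖ ^ 2)).mono' (hm.norm.pow 2) (ae_of_all _ fun x => ?_)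
  rw [Real.norm_of_nonneg (by positivity)]
  exact norm_vectorField_sq_le f x

theorem norm_toLp_vectorField_le
    (hk : Continuous (Function.uncurry (scalarKernel (d := d) H)))
    {μ : Measure (EuclideanSpace ℝ (Fin d))}
    (hμ : Integrable (fun x => scalarKernel H x x) μ)
    (f : PiLp 2 (fun _ : Fin d => H)) :
    ‖(memLp_vectorField hk hμ f).toLp (vectorField f)‖ ≤
      Real.sqrt (∫ x, scalarKernel H x x ∂μ) * ‖f‖ := by
  have h0 : 0 ≤ ∫ x, scalarKernel H x x ∂μ :=
    integral_nonneg fun x => by rw [scalarKernel_self]; positivity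
  refine (sq_le_sq₀ (norm_nonneg _) (by positivity)).1 ?_
  rw [mul_pow, Real.sq_sqrt h0, ← integral_mul_const, ← real_inner_self_eq_norm_sq,
    L2.inner_def]
  have hm := memLp_vectorField hk hμ f
  have h1 : ∫ x, ⟪hm.toLp (vectorField f) x, hm.toLp (vectorField f) x⟫ ∂μ =
      ∫ x, ‖vectorField f x‖ ^ 2 ∂μ := by
    refine integral_congr_ae ?_
    filter_upwards [hm.coeFn_toLp] with x hx
    rw [hx, real_inner_self_eq_norm_sq]
  rw [h1]
  refine integral_mono ((memLp_two_iff_integrable_sq_norm hm.1).1 hm) (hμ.mul_const _) fun x => ?_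
  have := norm_vectorField_sq_le f x
  simp only
  linarith

open scoped Classical in
/-- The inclusion `ι_{k,μ} : H_k^d → L₂^d(μ)` of a Hilbert space with continuous kernel `k`
such that `∫ k(x,x) dμ(x) < ∞` (by convention, the zero map if one of these conditions
fails). -/
noncomputable def inclusionL2 (H : Type*) [NormedAddCommGroup H] [InnerProductSpace ℝ H]
    [CompleteSpace H] [RKHS ℝ H (EuclideanSpace ℝ (Fin d)) ℝ]
    (μ : Measure (EuclideanSpace ℝ (Fin d))) :
    PiLp 2 (fun _ : Fin d => H) →L[ℝ] Lp (EuclideanSpace ℝ (Fin d)) 2 μ :=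
  if h : Continuous (Function.uncurry (scalarKernel (d := d) H)) ∧
      Integrable (fun x : EuclideanSpace ℝ (Fin d) => scalarKernel H x x) μ then
    LinearMap.mkContinuous
      { toFun := fun f => (memLp_vectorField h.1 h.2 f).toLp (vectorField f)
        map_add' := fun f g => by
          rw [← MemLp.toLp_add]
          congr 1
          ext x i
          simp [vectorField]
        map_smul' := fun c f => by
          rw [RingHom.id_apply, ← MemLp.toLp_const_smul]
          congr 1
          ext x i
          simp [vectorField] }
      (Real.sqrt (∫ x, scalarKernel H x x ∂μ))
      (norm_toLp_vectorField_le h.1 h.2)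
  else 0

/-- The integral operator `T_{k,μ} = ι_{k,μ} ι_{k,μ}^*` on `L₂^d(μ)`. -/
noncomputable def kernelOperator (H : Type*) [NormedAddCommGroup H] [InnerProductSpace ℝ H]
    [CompleteSpace H] [RKHS ℝ H (EuclideanSpace ℝ (Fin d)) ℝ]
    (μ : Measure (EuclideanSpace ℝ (Fin d))) :
    Lp (EuclideanSpace ℝ (Fin d)) 2 μ →L[ℝ] Lp (EuclideanSpace ℝ (Fin d)) 2 μ :=
  (inclusionL2 H μ).comp (inclusionL2 H μ).adjoint

end Inclusion

/-! ### Fractional powers and pre-images -/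

/-- The power `T ^ γ`, `γ > 0`, of a compact positive self-adjoint operator `T` on a real Hilbert
space, through its spectral decomposition: `T ^ γ f = ∑_λ λ ^ γ P_λ f`, where `P_λ` is the
orthogonal projection onto the eigenspace `ker (T - λ)`. -/
noncomputable def spectralPower {G : Type*} [NormedAddCommGroup G] [InnerProductSpace ℝ G]
    [CompleteSpace G] (T : G →L[ℝ] G) (γ : ℝ) (f : G) : G :=
  ∑' l : ℝ, l ^ γ • (T - l • ContinuousLinearMap.id ℝ G).ker.starProjection f

/-- The norm `‖𝔍(ρ, γ)‖_{L₂^d(ρ)}` of the pre-image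
`𝔍(ρ, γ) = (ι_{k,ρ} ι_{k,ρ}^*)^{-γ} ∇ log (ρ / π)`: the least norm of an `h ∈ L₂^d(ρ)` with
`(ι_{k,ρ} ι_{k,ρ}^*)^γ h = ∇ log (ρ / π)`, and `∞` if there is no such `h`. -/
noncomputable def preimageNorm {d : ℕ} (H : Type*) [NormedAddCommGroup H] [InnerProductSpace ℝ H]
    [CompleteSpace H] [RKHS ℝ H (EuclideanSpace ℝ (Fin d)) ℝ]
    (ρ π : EuclideanSpace ℝ (Fin d) → ℝ) (γ : ℝ) : ℝ≥0∞ :=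
  ⨅ (h : Lp (EuclideanSpace ℝ (Fin d)) 2 (densityMeasure ρ))
    (_ : (spectralPower (kernelOperator H (densityMeasure ρ)) γ h :
        Lp (EuclideanSpace ℝ (Fin d)) 2 (densityMeasure ρ)) =ᵐ[densityMeasure ρ] score ρ π),
    ‖h‖ₑ

/-! ### The regularized Stein variational gradient flow -/

open scoped Classical in
/-- `∇ log (ρ / π)` as an element of `L₂^d(ρ)` (by convention `0` if it is not square
integrable). -/
noncomputable def scoreL2 {d : ℕ} (ρ π : EuclideanSpace ℝ (Fin d) → ℝ) :
    Lp (EuclideanSpace ℝ (Fin d)) 2 (densityMeasure ρ) :=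
  if h : MemLp (score ρ π) 2 (densityMeasure ρ) then h.toLp (score ρ π) else 0

/-- The vector field
`ι_{k,ρ} ((1 - ν) ι_{k,ρ}^* ι_{k,ρ} + ν I)⁻¹ ι_{k,ρ}^* ∇ log (ρ / π)` on `ℝ^d`. -/
noncomputable def rsvgfField {d : ℕ} (H : Type*) [NormedAddCommGroup H] [InnerProductSpace ℝ H]
    [CompleteSpace H] [RKHS ℝ H (EuclideanSpace ℝ (Fin d)) ℝ] (ν : ℝ)
    (ρ π : EuclideanSpace ℝ (Fin d) → ℝ) :
    EuclideanSpace ℝ (Fin d) → EuclideanSpace ℝ (Fin d) :=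
  vectorField (ContinuousLinearMap.inverse
    ((1 - ν) • ((inclusionL2 H (densityMeasure ρ)).adjoint.comp
        (inclusionL2 H (densityMeasure ρ)))
      + ν • ContinuousLinearMap.id ℝ (PiLp 2 (fun _ : Fin d => H)))
    ((inclusionL2 H (densityMeasure ρ)).adjoint (scoreL2 ρ π)))

/-- `(ρ_t)_{t ≥ 0}` is a solution of the regularized Stein variational gradient flow
`∂_t ρ_t = ∇ · (ρ_t v_t)`, where `v_t` is the vector field `rsvgfField H ν (ρ t) π`:
a curve of densities in `𝒫(ℝ^d)`, continuous in time together with its spatial gradient, along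
which `v_t` is defined and the flux `ρ_t v_t` is locally integrable in time, and which satisfies
the equation in the weak sense. -/
structure IsRSVGF {d : ℕ} (H : Type*) [NormedAddCommGroup H] [InnerProductSpace ℝ H]
    [CompleteSpace H] [RKHS ℝ H (EuclideanSpace ℝ (Fin d)) ℝ] (ν : ℝ)
    (π : EuclideanSpace ℝ (Fin d) → ℝ) (ρ : ℝ → EuclideanSpace ℝ (Fin d) → ℝ) : Prop where
  density : ∀ t, 0 ≤ t → IsSmoothDensity (ρ t)
  continuous : ContinuousOn (Function.uncurry ρ) (Ici 0 ×ˢ univ)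
  continuous_gradient :
    ContinuousOn (fun p : ℝ × EuclideanSpace ℝ (Fin d) => gradient (ρ p.1) p.2) (Ici 0 ×ˢ univ)
  kernel_integrable : ∀ t, 0 < t →
    Integrable (fun x : EuclideanSpace ℝ (Fin d) => scalarKernel H x x) (densityMeasure (ρ t))
  score_memLp : ∀ t, 0 < t → MemLp (score (ρ t) π) 2 (densityMeasure (ρ t))
  field_measurable :
    AEStronglyMeasurable (fun p : ℝ × EuclideanSpace ℝ (Fin d) => rsvgfField H ν (ρ p.1) π p.2)
      ((volume.restrict (Ioi 0)).prod volume)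
  flux_integrable : ∀ T, 0 < T →
    ∫⁻ t in Ioc 0 T, ∫⁻ x, ‖rsvgfField H ν (ρ t) π x‖ₑ ∂(densityMeasure (ρ t)) < ⊤
  weak_equation : ∀ φ : ℝ × EuclideanSpace ℝ (Fin d) → ℝ, ContDiff ℝ ∞ φ → HasCompactSupport φ →
    (∫ t in Ioi (0 : ℝ), ∫ x, (deriv (fun s => φ (s, x)) t
        - ⟪gradient (fun y => φ (t, y)) x, rsvgfField H ν (ρ t) π x⟫) ∂(densityMeasure (ρ t)))
      + ∫ x, φ (0, x) ∂(densityMeasure (ρ 0)) = 0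

/-!
Write `s = ∇ log (ρ_t / π)`, `v = v_t` and `w = s - (1-ν) v` for the score, the velocity field and
the residual at time `t`, so that `I(ρ_t|π) = ‖s‖² = (1-ν) ⟪s, v⟫ + ⟪s, w⟫` in `L₂^d(ρ_t)`. The
theorem follows from a bound of `⟪s, w⟫` at fixed time and of `∫ ⟪s, v⟫ dt` by the entropy.

*Fixed time.* With `T = ι ι*` the residual solves `((1-ν) T + ν) w = ν s`, and `⟪w, v⟫ ≥ 0`
(`regularized_residual`); hence `‖w‖² ≤ ⟪s, w⟫` and `⟪s, v⟫ ≥ 0`. If `s = T^γ h`, expanding along the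
eigenspaces of `T` gives `⟪s, w⟫ = ∑ ν l^{2γ} / ((1-ν) l + ν) ‖P_l h‖²`, which Young's and Bessel's
inequalities bound by `ν^{2γ} (1-ν)^{-2γ} ‖h‖²` (`inner_spectralPower_le`).

*Entropy dissipation.* One needs `∫ ⟪s, v⟫ dt ≤ KL(ρ_0|π)`, where a priori only `ρ_t v_t` is
integrable in time. The weak equation is first tested with compactly supported `C¹` functions of
`x` on time intervals (`IsContinuityFlow.integral_sub`). Convexity of the entropy and a subdivision
of the time interval then give a chain rule that uses no time derivative of the density
(`IsContinuityFlow.sub_le_of_subgradient`). It is applied to an entropy whose derivative is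
a bounded truncation of `log`, multiplied by a spatial cutoff; the cutoff error tends to `0` since
the flux is integrable. The dissipation density `⟪s, v⟫` has no pointwise sign, but
`⟪s, v⟫ ≥ -|w|² / (4 (1-ν))` pointwise, and the fixed-time bound makes the right-hand side integrable
in time and space whenever the claimed bound is finite. So Fatou's lemma removes the truncations
(`IsContinuityFlow.dissipation_le`).

*Time averages.* The Fisher information is convex (`fisherInfo_avgDensity_le`), so `I(ρ̄_t|π)` is at
most `t⁻¹ ∫₀ᵗ I(ρ_s|π) ds`, which tends to `0` when the integral over `[0, ∞)` is finite.
-/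

/-! ### Regularized inverses and spectral powers on Hilbert spaces -/

section Operators

variable {F G : Type*} [NormedAddCommGroup F] [InnerProductSpace ℝ F] [CompleteSpace F]
  [NormedAddCommGroup G] [InnerProductSpace ℝ G] [CompleteSpace G]

/-- A coercive bounded operator on a Hilbert space is inverted by `ContinuousLinearMap.inverse`,
by the Lax–Milgram theorem. -/
theorem apply_inverse_of_coercive (A : F →L[ℝ] F) {c : ℝ} (hc : 0 < c)
    (hA : ∀ u, c * ‖u‖ * ‖u‖ ≤ ⟪A u, u⟫) (g : F) :
    A (ContinuousLinearMap.inverse A g) = g := by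
  have hB : IsCoercive ((innerSL ℝ (E := F)).comp A) := ⟨c, hc, fun u => by simpa using hA u⟩
  have hAe : A = (hB.continuousLinearEquivOfBilin : F →L[ℝ] F) := by
    ext u
    refine ext_inner_right ℝ fun w => ?_
    have h := hB.continuousLinearEquivOfBilin_apply u w
    simp only [ContinuousLinearMap.comp_apply, innerSL_apply_apply] at h
    exact h.symm
  rw [hAe, ContinuousLinearMap.inverse_equiv]
  simp

/-- The regularized solution operator applied to `s`: with `f = ((1-ν) ι*ι + ν)⁻¹ ι* s`, the
residual `w = s - (1-ν) ι f` has a nonnegative inner product with `ι f`, and it solves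
`((1-ν) ι ι* + ν) w = ν s`. -/
theorem regularized_residual (ι : F →L[ℝ] G) {ν : ℝ} (hν₀ : 0 < ν) (hν₁ : ν < 1) (s : G) :
    let f := ContinuousLinearMap.inverse ((1 - ν) • (ι.adjoint.comp ι)
      + ν • ContinuousLinearMap.id ℝ F) (ι.adjoint s)
    0 ≤ ⟪s - (1 - ν) • ι f, ι f⟫ ∧
      (1 - ν) • (ι.comp ι.adjoint) (s - (1 - ν) • ι f) + ν • (s - (1 - ν) • ι f) = ν • s := by
  intro f
  have hf : (1 - ν) • ι.adjoint (ι f) + ν • f = ι.adjoint s := by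
    refine apply_inverse_of_coercive ((1 - ν) • (ι.adjoint.comp ι)
      + ν • ContinuousLinearMap.id ℝ F) hν₀ (fun u => ?_) (ι.adjoint s)
    simp only [add_apply, smul_apply,
      ContinuousLinearMap.comp_apply, ContinuousLinearMap.id_apply, inner_add_left,
      real_inner_smul_left, ContinuousLinearMap.adjoint_inner_left, real_inner_self_eq_norm_mul_norm]
    have := mul_nonneg (sub_nonneg.2 hν₁.le) (mul_self_nonneg ‖ι u‖)
    linarith
  have hw : ι.adjoint (s - (1 - ν) • ι f) = ν • f := by
    rw [map_sub, map_smul, ← hf]; abel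
  constructor
  · rw [← ContinuousLinearMap.adjoint_inner_left, hw, real_inner_smul_left,
      real_inner_self_eq_norm_mul_norm]
    positivity
  · rw [ContinuousLinearMap.comp_apply, hw, map_smul, smul_sub, smul_comm (1 - ν) ν]
    abel

variable (T : G →L[ℝ] G)

/-- The orthogonal projection onto the eigenspace `ker (T - l)`. -/
noncomputable abbrev eigenProj (l : ℝ) : G →L[ℝ] G :=
  (T - l • ContinuousLinearMap.id ℝ G).ker.starProjection

variable {T}

theorem map_eigenProj (l : ℝ) (h : G) : T (eigenProj T l h) = l • eigenProj T l h := by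
  have h1 : (T - l • ContinuousLinearMap.id ℝ G) (eigenProj T l h) = 0 :=
    Submodule.starProjection_apply_mem (T - l • ContinuousLinearMap.id ℝ G).ker h
  exact sub_eq_zero.1 h1

theorem inner_eigenProj_eigenProj (l : ℝ) (h w : G) :
    ⟪eigenProj T l h, eigenProj T l w⟫ = ⟪eigenProj T l h, w⟫ := by
  rw [← Submodule.inner_starProjection_left_eq_right, Submodule.starProjection_eq_self_iff.2]
  exact Submodule.starProjection_apply_mem _ _

theorem inner_map_eigenProj (hT : ∀ x y, ⟪T x, y⟫ = ⟪x, T y⟫) (l : ℝ) (h w : G) :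
    ⟪eigenProj T l h, T w⟫ = l * ⟪eigenProj T l h, w⟫ := by
  rw [← hT, map_eigenProj, real_inner_smul_left]

theorem inner_eigenProj_of_ne (hT : ∀ x y, ⟪T x, y⟫ = ⟪x, T y⟫) {l m : ℝ} (hlm : l ≠ m) (h w : G) :
    ⟪eigenProj T l h, eigenProj T m w⟫ = 0 := by
  have h1 := inner_map_eigenProj hT l h (eigenProj T m w)
  rw [map_eigenProj, real_inner_smul_right] at h1
  have h2 : (l - m) * ⟪eigenProj T l h, eigenProj T m w⟫ = 0 := by linarith
  exact (mul_eq_zero.1 h2).resolve_left (sub_ne_zero.2 hlm)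

/-- Bessel's inequality for the eigenspaces of a symmetric operator. -/
theorem sum_norm_sq_eigenProj_le (hT : ∀ x y, ⟪T x, y⟫ = ⟪x, T y⟫) (h : G) (S : Finset ℝ) :
    ∑ l ∈ S, ‖eigenProj T l h‖ ^ 2 ≤ ‖h‖ ^ 2 := by
  set p := ∑ l ∈ S, eigenProj T l h with hp
  have h1 : ⟪p, h⟫ = ∑ l ∈ S, ‖eigenProj T l h‖ ^ 2 := by
    rw [hp, sum_inner]
    refine Finset.sum_congr rfl fun l _ => ?_
    rw [← inner_eigenProj_eigenProj, real_inner_self_eq_norm_sq]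
  have h2 : ⟪p, p⟫ = ∑ l ∈ S, ‖eigenProj T l h‖ ^ 2 := by
    rw [hp, sum_inner]
    refine Finset.sum_congr rfl fun l hl => ?_
    rw [inner_sum, Finset.sum_eq_single l
      (fun m _ hml => inner_eigenProj_of_ne hT (Ne.symm hml) h h) (fun hn => absurd hl hn),
      real_inner_self_eq_norm_sq]
  have h3 : 0 ≤ ⟪h - p, h - p⟫ := real_inner_self_nonneg
  rw [inner_sub_left, inner_sub_right, inner_sub_right, real_inner_comm p h, h1, h2,
    real_inner_self_eq_norm_sq] at h3
  linarith

theorem eigenProj_eq_zero_of_neg (hpos : ∀ x, 0 ≤ ⟪T x, x⟫) {l : ℝ} (hl : l < 0) (h : G) :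
    eigenProj T l h = 0 := by
  have h1 := hpos (eigenProj T l h)
  rw [map_eigenProj, real_inner_smul_left, real_inner_self_eq_norm_sq] at h1
  by_contra hne
  have : 0 < ‖eigenProj T l h‖ ^ 2 := by positivity
  nlinarith

theorem eigenProj_eq_zero_of_norm_lt {l : ℝ} (hl : ‖T‖ < l) (h : G) :
    eigenProj T l h = 0 := by
  have h1 := T.le_opNorm (eigenProj T l h)
  rw [map_eigenProj, norm_smul, Real.norm_of_nonneg ((norm_nonneg T).trans hl.le)] at h1
  by_contra hne
  have : 0 < ‖eigenProj T l h‖ := norm_pos_iff.2 hne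
  nlinarith

/-- The series defining a spectral power converges unconditionally: its terms are orthogonal and
their squared norms are dominated by those of the projections of `h`. -/
theorem summable_spectralPower (hT : ∀ x y, ⟪T x, y⟫ = ⟪x, T y⟫) (hpos : ∀ x, 0 ≤ ⟪T x, x⟫)
    {γ : ℝ} (hγ : 0 < γ) (h : G) : Summable fun l : ℝ => l ^ γ • eigenProj T l h := by
  let V : ℝ → Submodule ℝ G := fun l => (T - l • ContinuousLinearMap.id ℝ G).ker
  have hV : OrthogonalFamily ℝ (fun l => V l) (fun l => (V l).subtypeₗᵢ) := by
    intro l m hlm x y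
    have h1 : eigenProj T l (x : G) = x := Submodule.starProjection_eq_self_iff.2 x.2
    have h2 : eigenProj T m (y : G) = y := Submodule.starProjection_eq_self_iff.2 y.2
    have h3 := inner_eigenProj_of_ne hT hlm (x : G) (y : G)
    rwa [h1, h2] at h3
  have hs := hV.summable_iff_norm_sq_summable
    (fun l => l ^ γ • (V l).orthogonalProjectionOnto h)
  refine (summable_congr fun l => ?_).1 (hs.2 ?_)
  · rfl
  · refine Summable.of_nonneg_of_le (fun _ => by positivity) (fun l => ?_)
      ((summable_of_sum_le (fun _ => by positivity)
        (sum_norm_sq_eigenProj_le hT h)).mul_left ((‖T‖ ^ γ) ^ 2))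
    have hE : ‖(V l).orthogonalProjectionOnto h‖ = ‖eigenProj T l h‖ := rfl
    rw [norm_smul, mul_pow, hE]
    rcases lt_or_ge l 0 with hl | hl
    · simp [eigenProj_eq_zero_of_neg hpos hl]
    rcases lt_or_ge ‖T‖ l with hl' | hl'
    · simp [eigenProj_eq_zero_of_norm_lt hl']
    gcongr
    rw [Real.norm_of_nonneg (by positivity)]
    gcongr

/-- Young's inequality `((1-ν) l)^{2γ} ν^{1-2γ} ≤ (1-ν) l + ν` in the form in which it bounds the
regularized multiplier. -/
theorem regularized_multiplier_le {ν γ l : ℝ} (hν₀ : 0 < ν) (hν₁ : ν < 1) (hγ₀ : 0 < γ)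
    (hγ₁ : γ ≤ 1 / 2) (hl : 0 ≤ l) :
    ν * (l ^ γ * l ^ γ) / ((1 - ν) * l + ν) ≤ ν ^ (2 * γ) * (1 - ν) ^ (-(2 * γ)) := by
  have h1 : 0 < 1 - ν := by linarith
  have hy := Real.geom_mean_le_arith_mean2_weighted (w₁ := 2 * γ) (w₂ := 1 - 2 * γ)
    (p₁ := (1 - ν) * l) (p₂ := ν) (by linarith) (by linarith) (by positivity) hν₀.le (by ring)
  have hy' : ((1 - ν) * l) ^ (2 * γ) * ν ^ (1 - 2 * γ) ≤ (1 - ν) * l + ν := by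
    refine hy.trans ?_
    have : 0 ≤ (1 - ν) * l := by positivity
    nlinarith
  rw [div_le_iff₀ (by positivity)]
  refine le_trans (le_of_eq ?_) (mul_le_mul_of_nonneg_left hy' (by positivity))
  have hll : l ^ γ * l ^ γ = l ^ (2 * γ) := by
    rw [two_mul, Real.rpow_add_of_nonneg hl hγ₀.le hγ₀.le]
  rw [hll, Real.mul_rpow h1.le hl, Real.rpow_sub hν₀, Real.rpow_one, Real.rpow_neg h1.le]
  have : (1 - ν) ^ (2 * γ) ≠ 0 := (Real.rpow_pos_of_pos h1 _).ne'
  have : ν ^ (2 * γ) ≠ 0 := (Real.rpow_pos_of_pos hν₀ _).ne'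
  field_simp

/-- If `s = T ^ γ h` and `w` is the solution of `((1-ν) T + ν) w = ν s`, then `⟪s, w⟫` is
`∑ ν l^{2γ} / ((1-ν) l + ν) ‖P_l h‖²`, and the multiplier is bounded by Young's inequality. -/
theorem inner_spectralPower_le (hT : ∀ x y, ⟪T x, y⟫ = ⟪x, T y⟫) (hpos : ∀ x, 0 ≤ ⟪T x, x⟫)
    {ν γ : ℝ} (hν₀ : 0 < ν) (hν₁ : ν < 1) (hγ₀ : 0 < γ) (hγ₁ : γ ≤ 1 / 2) (h w : G)
    (hw : (1 - ν) • T w + ν • w = ν • spectralPower T γ h) :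
    ⟪spectralPower T γ h, w⟫ ≤ ν ^ (2 * γ) * (1 - ν) ^ (-(2 * γ)) * ‖h‖ ^ 2 := by
  have h1 : 0 < 1 - ν := by linarith
  have hc : 0 ≤ ν ^ (2 * γ) * (1 - ν) ^ (-(2 * γ)) := by positivity
  have hs : HasSum (fun l : ℝ => l ^ γ • eigenProj T l h) (spectralPower T γ h) :=
    (summable_spectralPower hT hpos hγ₀ h).hasSum
  have hcomp : ∀ l : ℝ, ⟪eigenProj T l h, spectralPower T γ h⟫ =
      l ^ γ * ‖eigenProj T l h‖ ^ 2 := fun l => by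
    have h2 : HasSum (fun m : ℝ => ⟪eigenProj T l h, m ^ γ • eigenProj T m h⟫)
        ⟪eigenProj T l h, spectralPower T γ h⟫ := hs.mapL (innerSL ℝ (eigenProj T l h))
    have h3 := hasSum_single (f := fun m : ℝ => ⟪eigenProj T l h, m ^ γ • eigenProj T m h⟫) l
      (fun m hm => by rw [real_inner_smul_right, inner_eigenProj_of_ne hT hm.symm, mul_zero])
    rw [h2.unique h3, real_inner_smul_right, real_inner_self_eq_norm_sq]
  have hterm : ∀ l : ℝ, ⟪l ^ γ • eigenProj T l h, w⟫ ≤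
      ν ^ (2 * γ) * (1 - ν) ^ (-(2 * γ)) * ‖eigenProj T l h‖ ^ 2 := fun l => by
    rcases lt_or_ge l 0 with hl | hl
    · simp [eigenProj_eq_zero_of_neg hpos hl]
    have hpw : 0 < (1 - ν) * l + ν := by positivity
    have h2 : ((1 - ν) * l + ν) * ⟪eigenProj T l h, w⟫ =
        ν * (l ^ γ * ‖eigenProj T l h‖ ^ 2) := by
      rw [← hcomp, ← real_inner_smul_right _ (spectralPower T γ h), ← hw, inner_add_right,
        real_inner_smul_right, real_inner_smul_right, inner_map_eigenProj hT]
      ring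
    have h3 : ⟪eigenProj T l h, w⟫ =
        ν * (l ^ γ * ‖eigenProj T l h‖ ^ 2) / ((1 - ν) * l + ν) := by
      rw [eq_div_iff hpw.ne', mul_comm, h2]
    rw [real_inner_smul_left, h3]
    calc l ^ γ * (ν * (l ^ γ * ‖eigenProj T l h‖ ^ 2) / ((1 - ν) * l + ν))
        = ν * (l ^ γ * l ^ γ) / ((1 - ν) * l + ν) * ‖eigenProj T l h‖ ^ 2 := by ring
      _ ≤ _ := by gcongr; exact regularized_multiplier_le hν₀ hν₁ hγ₀ hγ₁ hl
  have hsum : HasSum (fun l : ℝ => ⟪l ^ γ • eigenProj T l h, w⟫) ⟪spectralPower T γ h, w⟫ := by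
    simpa only [innerSL_apply_apply, real_inner_comm] using hs.mapL (innerSL ℝ w)
  refine hasSum_le_of_sum_le hsum fun S => ?_
  refine (Finset.sum_le_sum fun l _ => hterm l).trans ?_
  rw [← Finset.mul_sum]
  exact mul_le_mul_of_nonneg_left (sum_norm_sq_eigenProj_le hT h S) hc

end Operators

/-! ### The velocity field and its residual at a fixed time -/

section FixedTime

variable {d : ℕ} {H : Type*} [NormedAddCommGroup H] [InnerProductSpace ℝ H]
  [CompleteSpace H] [RKHS ℝ H (EuclideanSpace ℝ (Fin d)) ℝ]

theorem inclusionL2_ae_eq (hk : Continuous (Function.uncurry (scalarKernel (d := d) H)))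
    {μ : Measure (EuclideanSpace ℝ (Fin d))} (hμ : Integrable (fun x => scalarKernel H x x) μ)
    (f : PiLp 2 (fun _ : Fin d => H)) : inclusionL2 H μ f =ᵐ[μ] vectorField f := by
  have h : inclusionL2 H μ f = (memLp_vectorField hk hμ f).toLp (vectorField f) := by
    rw [inclusionL2, dif_pos ⟨hk, hμ⟩]
    rfl
  rw [h]
  exact MemLp.coeFn_toLp _

theorem kernelOperator_symmetric (μ : Measure (EuclideanSpace ℝ (Fin d)))
    (x y : Lp (EuclideanSpace ℝ (Fin d)) 2 μ) :
    ⟪kernelOperator H μ x, y⟫ = ⟪x, kernelOperator H μ y⟫ := by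
  simp only [kernelOperator, ContinuousLinearMap.comp_apply]
  rw [← ContinuousLinearMap.adjoint_inner_right, ContinuousLinearMap.adjoint_inner_left]

theorem kernelOperator_nonneg (μ : Measure (EuclideanSpace ℝ (Fin d)))
    (x : Lp (EuclideanSpace ℝ (Fin d)) 2 μ) : 0 ≤ ⟪kernelOperator H μ x, x⟫ := by
  simp only [kernelOperator, ContinuousLinearMap.comp_apply]
  rw [← ContinuousLinearMap.adjoint_inner_right]
  exact real_inner_self_nonneg

/-- A bound by the square of each admissible norm is a bound by the square of the infimum. -/
theorem le_mul_preimageNorm_sq {ρ π : EuclideanSpace ℝ (Fin d) → ℝ} {γ : ℝ}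
    (hI : preimageNorm H ρ π γ < ⊤) {a c : ℝ≥0∞} (hc : c ≠ ⊤)
    (h : ∀ h : Lp (EuclideanSpace ℝ (Fin d)) 2 (densityMeasure ρ),
      (spectralPower (kernelOperator H (densityMeasure ρ)) γ h :
        Lp (EuclideanSpace ℝ (Fin d)) 2 (densityMeasure ρ)) =ᵐ[densityMeasure ρ] score ρ π →
      a ≤ c * ‖h‖ₑ ^ 2) :
    a ≤ c * preimageNorm H ρ π γ ^ 2 := by
  have hcont : Tendsto (fun r : ℝ≥0∞ => c * r ^ 2) (𝓝[>] preimageNorm H ρ π γ)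
      (𝓝 (c * preimageNorm H ρ π γ ^ 2)) :=
    ((ENNReal.continuous_const_mul hc).comp (ENNReal.continuous_pow 2)).continuousWithinAt
  have : (𝓝[>] preimageNorm H ρ π γ).NeBot := nhdsGT_neBot_of_exists_gt ⟨⊤, hI⟩
  refine ge_of_tendsto hcont ?_
  filter_upwards [self_mem_nhdsWithin] with r hr
  obtain ⟨g, hg⟩ := iInf_lt_iff.1 (show preimageNorm H ρ π γ < r from hr)
  obtain ⟨hg1, hg2⟩ := iInf_lt_iff.1 hg
  exact (h g hg1).trans (by gcongr)

variable {ρ π : EuclideanSpace ℝ (Fin d) → ℝ} {ν : ℝ}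

theorem memLp_rsvgfField (hk : Continuous (Function.uncurry (scalarKernel (d := d) H)))
    (hμ : Integrable (fun x : EuclideanSpace ℝ (Fin d) => scalarKernel H x x) (densityMeasure ρ)) :
    MemLp (rsvgfField H ν ρ π) 2 (densityMeasure ρ) :=
  memLp_vectorField hk hμ _

/-- With `s = ∇ log (ρ / π)`, `v` the velocity field and `w = s - (1-ν) v` the residual:
`⟪s, v⟫ ≥ 0` and `‖w‖² ≤ ⟪s, w⟫ ≤ ν^{2γ} (1-ν)^{-2γ} ‖𝔍(ρ, γ)‖²` in `L₂^d(ρ)`. -/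
theorem residual_estimates (hk : Continuous (Function.uncurry (scalarKernel (d := d) H)))
    (hν₀ : 0 < ν) (hν₁ : ν < 1)
    (hμ : Integrable (fun x : EuclideanSpace ℝ (Fin d) => scalarKernel H x x) (densityMeasure ρ))
    (hs : MemLp (score ρ π) 2 (densityMeasure ρ)) {γ : ℝ} (hγ : γ ∈ Ioc (0 : ℝ) (1 / 2))
    (hI : preimageNorm H ρ π γ < ⊤) :
    0 ≤ ∫ x, ⟪score ρ π x, rsvgfField H ν ρ π x⟫ ∂(densityMeasure ρ) ∧
    ∫ x, ‖score ρ π x - (1 - ν) • rsvgfField H ν ρ π x‖ ^ 2 ∂(densityMeasure ρ) ≤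
      ∫ x, ⟪score ρ π x, score ρ π x - (1 - ν) • rsvgfField H ν ρ π x⟫ ∂(densityMeasure ρ) ∧
    ENNReal.ofReal (∫ x, ⟪score ρ π x, score ρ π x - (1 - ν) • rsvgfField H ν ρ π x⟫
      ∂(densityMeasure ρ)) ≤
      ENNReal.ofReal (ν ^ (2 * γ) * (1 - ν) ^ (-(2 * γ))) * preimageNorm H ρ π γ ^ 2 := by
  set μ := densityMeasure ρ with hμdef
  set s := scoreL2 ρ π with hsdef
  have hs_ae : s =ᵐ[μ] score ρ π := by
    rw [hsdef, scoreL2, dif_pos hs]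
    exact MemLp.coeFn_toLp _
  obtain ⟨h1, h2⟩ := regularized_residual (inclusionL2 H μ) hν₀ hν₁ s
  set f := ContinuousLinearMap.inverse ((1 - ν) • ((inclusionL2 H μ).adjoint.comp
      (inclusionL2 H μ)) + ν • ContinuousLinearMap.id ℝ (PiLp 2 (fun _ : Fin d => H)))
      ((inclusionL2 H μ).adjoint s) with hf
  have hvf : rsvgfField H ν ρ π = vectorField f := rfl
  have hv_ae : inclusionL2 H μ f =ᵐ[μ] rsvgfField H ν ρ π := hvf ▸ inclusionL2_ae_eq hk hμ f
  set v := inclusionL2 H μ f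
  set w := s - (1 - ν) • v with hw
  have hw_ae : w =ᵐ[μ] fun x => score ρ π x - (1 - ν) • rsvgfField H ν ρ π x := by
    filter_upwards [Lp.coeFn_sub s ((1 - ν) • v), Lp.coeFn_smul (1 - ν) v, hs_ae, hv_ae]
      with x e1 e2 e3 e4
    rw [hw, e1, Pi.sub_apply, e2, Pi.smul_apply, e3, e4]
  have i1 : ⟪s, v⟫ = ∫ x, ⟪score ρ π x, rsvgfField H ν ρ π x⟫ ∂μ := by
    rw [L2.inner_def]
    refine integral_congr_ae ?_
    filter_upwards [hs_ae, hv_ae] with x e1 e2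
    rw [e1, e2]
  have i2 : ⟪w, w⟫ = ∫ x, ‖score ρ π x - (1 - ν) • rsvgfField H ν ρ π x‖ ^ 2 ∂μ := by
    rw [L2.inner_def]
    refine integral_congr_ae ?_
    filter_upwards [hw_ae] with x e1
    rw [e1, real_inner_self_eq_norm_sq]
  have i3 : ⟪s, w⟫ =
      ∫ x, ⟪score ρ π x, score ρ π x - (1 - ν) • rsvgfField H ν ρ π x⟫ ∂μ := by
    rw [L2.inner_def]
    refine integral_congr_ae ?_
    filter_upwards [hs_ae, hw_ae] with x e1 e2
    rw [e1, e2]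
  have hsw : s = w + (1 - ν) • v := by rw [hw]; abel
  have hν' : 0 ≤ 1 - ν := by linarith
  rw [← i1, ← i2, ← i3]
  refine ⟨?_, ?_, ?_⟩
  · rw [hsw, inner_add_left, real_inner_smul_left]
    exact add_nonneg h1 (mul_nonneg hν' real_inner_self_nonneg)
  · conv_rhs => rw [hsw, inner_add_left, real_inner_smul_left, real_inner_comm]
    exact le_add_of_nonneg_right (mul_nonneg hν' (by rwa [real_inner_comm]))
  · refine le_mul_preimageNorm_sq hI ENNReal.ofReal_ne_top fun h hh => ?_
    have hsh : s = spectralPower (kernelOperator H μ) γ h :=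
      Lp.ext (hs_ae.trans hh.symm)
    rw [hsh] at h2 ⊢
    have h3 := inner_spectralPower_le (kernelOperator_symmetric (H := H) μ)
      (kernelOperator_nonneg μ) hν₀ hν₁ hγ.1 hγ.2 h w (by rw [← hsh] at h2 ⊢; exact h2)
    refine (ENNReal.ofReal_le_ofReal h3).trans (le_of_eq ?_)
    rw [ENNReal.ofReal_mul (by have : 0 < 1 - ν := by linarith
                               positivity), ENNReal.ofReal_pow (norm_nonneg _), ofReal_norm]

end FixedTime

/-! ### The weak equation in integrated form -/

/-- A continuous `m` whose weak derivative on `[0, ∞)`, tested against functions that need not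
vanish at `0`, is `-q`, satisfies `m t = m 0 - ∫₀ᵗ q`. -/
theorem eq_sub_integral_of_weak_deriv {m q : ℝ → ℝ} (hm : ContinuousOn m (Ici 0))
    (hq : ∀ T, 0 < T → IntegrableOn q (Ioc 0 T))
    (hw : ∀ η : ℝ → ℝ, ContDiff ℝ ∞ η → HasCompactSupport η →
      (∫ t in Ioi (0 : ℝ), (deriv η t * m t - η t * q t)) + η 0 * m 0 = 0)
    {t : ℝ} (ht : 0 ≤ t) : m t = m 0 - ∫ s in (0 : ℝ)..t, q s := by
  have hqi : ∀ T, 0 ≤ T → IntervalIntegrable q volume 0 T := fun T hT => by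
    rcases hT.eq_or_lt with rfl | hT
    · simp
    · exact (intervalIntegrable_iff_integrableOn_Ioc_of_le hT.le).2 (hq T hT)
  have hPc : ContinuousOn (fun t => ∫ s in (0 : ℝ)..t, q s) (Ici 0) := by
    intro x hx
    have h1 := intervalIntegral.continuousOn_primitive_interval' (hqi (x + 1) (by
      have : 0 ≤ x := hx
      linarith)) left_mem_uIcc
    have hx0 : (0 : ℝ) ≤ x := hx
    rw [uIcc_of_le (by linarith)] at h1
    have h2 := h1 x ⟨hx0, by linarith⟩
    refine h2.mono_of_mem_nhdsWithin ?_
    rw [← Ici_inter_Iic]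
    exact inter_mem_nhdsWithin _ (Iic_mem_nhds (by linarith))
  set f : ℝ → ℝ := fun t => m t - m 0 + ∫ s in (0 : ℝ)..t, q s with hf
  have hfc : ContinuousOn f (Ici 0) := (hm.sub continuousOn_const).add hPc
  have key : ∀ g : ℝ → ℝ, ContDiff ℝ ∞ g → HasCompactSupport g → tsupport g ⊆ Ioi 0 →
      ∫ x, g x • f x = 0 := by
    intro g hg hgc hgs
    obtain ⟨B₀, hB₀⟩ := hgc.isCompact.bddAbove
    set B : ℝ := max B₀ 1 with hBdef
    have hB : 0 < B := lt_of_lt_of_le one_pos (le_max_right _ _)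
    have hg0 : ∀ x, x ≤ 0 → g x = 0 := fun x hx =>
      image_eq_zero_of_notMem_tsupport fun h => absurd (hgs h) (not_lt.2 hx)
    have hgB : ∀ x, B < x → g x = 0 := fun x hx =>
      image_eq_zero_of_notMem_tsupport fun h =>
        absurd ((hB₀ h).trans (le_max_left _ _)) (not_le.2 hx)
    have hcut : ∀ F : ℝ → ℝ, (∀ x, B < x → F x = 0) →
        ∫ x in Ioi (0 : ℝ), F x = ∫ x in (0 : ℝ)..B, F x := fun F hF => by
      rw [intervalIntegral.integral_of_le hB.le]
      refine setIntegral_eq_of_subset_of_forall_sdiff_eq_zero measurableSet_Ioi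
        Ioc_subset_Ioi_self fun x hx => hF x ?_
      by_contra h
      exact hx.2 ⟨hx.1, not_lt.1 h⟩
    -- `Z` is the primitive of `g` that vanishes beyond the support of `g`. Its product with a cutoff
    -- that is `1` on `[0, B]` is an admissible test function with derivative `g` on `(0, ∞)`.
    set Z : ℝ → ℝ := fun t => (∫ s in (0 : ℝ)..t, g s) - ∫ s in (0 : ℝ)..B, g s with hZ
    have hZd : ∀ x, HasDerivAt Z (g x) x := fun x =>
      (intervalIntegral.integral_hasDerivAt_right (hg.continuous.intervalIntegrable _ _)
        (hg.continuous.stronglyMeasurableAtFilter _ _) hg.continuous.continuousAt).sub_const _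
    have hZd' : deriv Z = g := funext fun x => (hZd x).deriv
    have hZs : ContDiff ℝ ∞ Z := by
      rw [contDiff_infty_iff_deriv]
      exact ⟨fun x => (hZd x).differentiableAt, hZd' ▸ hg⟩
    have hZB : ∀ x, B ≤ x → Z x = 0 := fun x hx => by
      rw [hZ]
      simp only
      rw [intervalIntegral.integral_interval_sub_left (hg.continuous.intervalIntegrable _ _)
        (hg.continuous.intervalIntegrable _ _), intervalIntegral.integral_of_le hx]
      exact setIntegral_eq_zero_of_forall_eq_zero fun y hy => hgB y hy.1
    let θ : ContDiffBump (0 : ℝ) := ⟨B + 1, B + 2, by linarith, by linarith⟩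
    have h1 := hw (fun x => θ x * Z x) (θ.contDiff.mul hZs) θ.hasCompactSupport.mul_right
    have hθ0 : θ 0 = 1 := θ.one_of_mem_closedBall (by simp [θ]; linarith)
    have heq : ∀ x, 0 < x → (fun x => θ x * Z x) =ᶠ[𝓝 x] Z := fun x hx => by
      rcases lt_or_ge x (B + 1) with h | h
      · have : x ∈ Metric.ball (0 : ℝ) (B + 1) := by
          rw [mem_ball_zero_iff, Real.norm_of_nonneg hx.le]; exact h
        filter_upwards [Metric.isOpen_ball.mem_nhds this] with y hy
        rw [θ.one_of_mem_closedBall (Metric.ball_subset_closedBall hy), one_mul]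
      · filter_upwards [Ioi_mem_nhds (show B < x by linarith)] with y hy
        rw [hZB y (le_of_lt hy), mul_zero]
    have h2 : ∫ t in Ioi (0 : ℝ), (deriv (fun x => θ x * Z x) t * m t - θ t * Z t * q t) =
        ∫ t in (0 : ℝ)..B, (g t * m t - Z t * q t) := by
      rw [hcut]
      · rw [intervalIntegral.integral_of_le hB.le, intervalIntegral.integral_of_le hB.le]
        refine setIntegral_congr_fun measurableSet_Ioc fun x hx => ?_
        rw [(heq x hx.1).deriv_eq, hZd', (heq x hx.1).eq_of_nhds]
      · intro x hx
        rw [(heq x (hB.trans hx)).deriv_eq, hZd', (heq x (hB.trans hx)).eq_of_nhds,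
          hgB x hx, hZB x hx.le]
        ring
    have hmi : IntervalIntegrable (fun t => g t * m t) volume 0 B := by
      refine ContinuousOn.intervalIntegrable (hg.continuous.continuousOn.mul (hm.mono ?_))
      rw [uIcc_of_le hB.le]
      exact Icc_subset_Ici_self
    have hPi : IntervalIntegrable (fun t => g t * ∫ s in (0 : ℝ)..t, q s) volume 0 B := by
      refine ContinuousOn.intervalIntegrable (hg.continuous.continuousOn.mul (hPc.mono ?_))
      rw [uIcc_of_le hB.le]
      exact Icc_subset_Ici_self
    have hZq : IntervalIntegrable (fun t => Z t * q t) volume 0 B :=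
      (hqi B hB.le).continuousOn_mul hZs.continuous.continuousOn
    have hqac := (hqi B hB.le).absolutelyContinuousOnInterval_intervalIntegral
      (c := 0) left_mem_uIcc
    have hZac : AbsolutelyContinuousOnInterval Z 0 B :=
      (hZs.of_le (by exact_mod_cast le_top)).contDiffOn.absolutelyContinuousOnInterval
    have h3 := hZac.integral_mul_deriv_eq_deriv_mul hqac
    have h4 : ∫ x in (0 : ℝ)..B, Z x * deriv (fun t => ∫ s in (0 : ℝ)..t, q s) x =
        ∫ x in (0 : ℝ)..B, Z x * q x := by
      refine intervalIntegral.integral_congr_ae ?_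
      filter_upwards [(hqi B hB.le).ae_hasDerivAt_integral] with x hx hx'
      rw [(hx (uIoc_subset_uIcc hx') 0 left_mem_uIcc).deriv]
    rw [h4, hZd', hZB B le_rfl, intervalIntegral.integral_same] at h3
    rw [h2, intervalIntegral.integral_sub hmi hZq, h3, hθ0] at h1
    have h5 : ∫ x, g x • f x = ∫ x in Ioi (0 : ℝ), g x • f x := by
      rw [setIntegral_eq_integral_of_forall_compl_eq_zero]
      intro x hx
      rw [hg0 x (not_lt.1 hx), zero_smul]
    have hZ0 : Z 0 = -∫ s in (0 : ℝ)..B, g s := by simp [hZ]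
    rw [h5, hcut _ (fun x hx => by rw [hgB x hx, zero_smul])]
    have h6 : ∫ x in (0 : ℝ)..B, g x • f x = (∫ x in (0 : ℝ)..B, g x * m x) -
        (∫ x in (0 : ℝ)..B, g x) * m 0 + ∫ x in (0 : ℝ)..B, g x * ∫ s in (0 : ℝ)..x, q s := by
      rw [← intervalIntegral.integral_mul_const, ← intervalIntegral.integral_sub hmi
        ((hg.continuous.intervalIntegrable _ _).mul_const _),
        ← intervalIntegral.integral_add (hmi.sub
        ((hg.continuous.intervalIntegrable _ _).mul_const _)) hPi]
      refine intervalIntegral.integral_congr fun x _ => ?_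
      simp only [hf, smul_eq_mul]
      ring
    rw [h6]
    rw [hZ0] at h1
    linarith
  have hae := isOpen_Ioi.ae_eq_zero_of_integral_contDiff_smul_eq_zero (μ := volume)
    ((hfc.mono Ioi_subset_Ici_self).locallyIntegrableOn measurableSet_Ioi) key
  have hzero : EqOn f (fun _ => 0) (Ioi 0) := by
    refine Measure.eqOn_open_of_ae_eq (μ := volume) ?_ isOpen_Ioi (hfc.mono Ioi_subset_Ici_self)
      continuousOn_const
    rwa [EventuallyEq, ae_restrict_iff' measurableSet_Ioi]
  rcases ht.eq_or_lt with rfl | ht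
  · simp
  · have := hzero ht
    simp only [hf] at this
    linarith

section WeakEquation

variable {E : Type*} [NormedAddCommGroup E] [NormedSpace ℝ E] [FiniteDimensional ℝ E]
  [MeasurableSpace E] [BorelSpace E]

/-- The weak form of the continuity equation `∂_t ρ = ∇ · J` on `[0, ∞) × E` with initial value
`ρ 0`, for a continuous `ρ` and a flux `J` that is integrable on bounded time intervals. -/
structure IsContinuityFlow (μ : Measure E) (ρ : ℝ → E → ℝ) (J : ℝ → E → E) : Prop where
  continuous : ContinuousOn (Function.uncurry ρ) (Ici 0 ×ˢ univ)
  integrable : ∀ t, 0 ≤ t → Integrable (ρ t) μ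
  flux_integrable : ∀ T, Integrable (Function.uncurry J) ((volume.restrict (Ioc 0 T)).prod μ)
  weak_equation : ∀ φ : ℝ × E → ℝ, ContDiff ℝ ∞ φ → HasCompactSupport φ →
    (∫ t in Ioi (0 : ℝ), ∫ x, (ρ t x * deriv (fun s => φ (s, x)) t
        - fderiv ℝ (fun y => φ (t, y)) x (J t x)) ∂μ) + ∫ x, ρ 0 x * φ (0, x) ∂μ = 0

theorem prod_restrict_univ {E : Type*} [MeasurableSpace E] (S : Set ℝ) (μ : Measure E) [SFinite μ] :
    (volume.restrict S).prod μ = ((volume : Measure ℝ).prod μ).restrict (S ×ˢ univ) := by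
  conv_lhs => rw [← Measure.restrict_univ (μ := μ), Measure.prod_restrict]

theorem aestronglyMeasurable_of_continuousOn_Ici {X : Type*} [TopologicalSpace X]
    [TopologicalSpace.PseudoMetrizableSpace X] [SecondCountableTopology X]
    {μ : Measure E} [SFinite μ] {f : ℝ × E → X}
    (hf : ContinuousOn f (Ici 0 ×ˢ univ)) {S : Set ℝ} (hS : MeasurableSet S) (hS0 : S ⊆ Ici 0) :
    AEStronglyMeasurable f ((volume.restrict S).prod μ) := by
  rw [prod_restrict_univ]
  exact (hf.mono (prod_mono hS0 le_rfl)).aestronglyMeasurable (hS.prod MeasurableSet.univ)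

theorem integrable_clm_apply_flux {μ : Measure E} [SFinite μ] {J : ℝ → E → E} {T : ℝ}
    (hJ : Integrable (Function.uncurry J) ((volume.restrict (Ioc 0 T)).prod μ))
    {D : ℝ × E → E →L[ℝ] ℝ} (hD : ContinuousOn D (Ici 0 ×ˢ univ)) {C : ℝ}
    (hC : ∀ t ∈ Ioc 0 T, ∀ x, ‖D (t, x)‖ ≤ C) :
    Integrable (fun p : ℝ × E => D p (J p.1 p.2)) ((volume.restrict (Ioc 0 T)).prod μ) := by
  have hDm : AEStronglyMeasurable D ((volume.restrict (Ioc 0 T)).prod μ) :=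
    aestronglyMeasurable_of_continuousOn_Ici hD measurableSet_Ioc fun t ht => ht.1.le
  refine (hJ.norm.const_mul C).mono'
    ((ContinuousLinearMap.id ℝ (E →L[ℝ] ℝ)).aestronglyMeasurable_comp₂ hDm hJ.1) ?_
  have : ∀ᵐ p : ℝ × E ∂((volume.restrict (Ioc 0 T)).prod μ), p ∈ Ioc 0 T ×ˢ (univ : Set E) := by
    rw [prod_restrict_univ]
    exact ae_restrict_mem (measurableSet_Ioc.prod MeasurableSet.univ)
  filter_upwards [this] with p hp
  refine (ContinuousLinearMap.le_opNorm _ _).trans ?_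
  exact mul_le_mul_of_nonneg_right (hC p.1 hp.1 p.2) (norm_nonneg _)

variable {μ : Measure E} [μ.IsAddHaarMeasure] {ρ : ℝ → E → ℝ} {J : ℝ → E → E}

theorem IsContinuityFlow.integrable_apply (h : IsContinuityFlow μ ρ J) {ψ : E → ℝ}
    (hψ : ContDiff ℝ 1 ψ) (hψc : HasCompactSupport ψ) (T : ℝ) :
    Integrable (fun p : ℝ × E => fderiv ℝ ψ p.2 (J p.1 p.2))
      ((volume.restrict (Ioc 0 T)).prod μ) := by
  have hc := hψ.continuous_fderiv one_ne_zero
  obtain ⟨C, hC⟩ := hc.bounded_above_of_compact_support (hψc.fderiv ℝ)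
  exact integrable_clm_apply_flux (h.flux_integrable T) (D := fun p => fderiv ℝ ψ p.2)
    (hc.comp continuous_snd).continuousOn (fun t _ x => hC x)

theorem IsContinuityFlow.integral_smooth (h : IsContinuityFlow μ ρ J) {ψ : E → ℝ}
    (hψ : ContDiff ℝ ∞ ψ) (hψc : HasCompactSupport ψ) {t : ℝ} (ht : 0 ≤ t) :
    ∫ x, ρ t x * ψ x ∂μ = ∫ x, ρ 0 x * ψ x ∂μ -
      ∫ s in (0 : ℝ)..t, ∫ x, fderiv ℝ ψ x (J s x) ∂μ := by
  have hψ1 : ContDiff ℝ 1 ψ := hψ.of_le (by exact_mod_cast le_top)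
  refine eq_sub_integral_of_weak_deriv (m := fun t => ∫ x, ρ t x * ψ x ∂μ)
    (q := fun s => ∫ x, fderiv ℝ ψ x (J s x) ∂μ) ?_ (fun T hT => ?_) (fun η hη hηc => ?_) ht
  · refine continuousOn_integral_of_compact_support hψc.isCompact ?_ ?_
    · exact h.continuous.mul (hψ.continuous.comp continuous_snd).continuousOn
    · intro p x _ hx
      rw [image_eq_zero_of_notMem_tsupport hx, mul_zero]
  · exact (h.integrable_apply hψ1 hψc T).integral_prod_left
  · have h1 := h.weak_equation (fun p => η p.1 * ψ p.2)
      ((hη.comp contDiff_fst).mul (hψ.comp contDiff_snd)) ?_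
    · -- The inner integral may be split only at times at which the flux is integrable in space.
      have h2 : ∀ᵐ t ∂(volume.restrict (Ioi (0 : ℝ))),
          Integrable (fun x => fderiv ℝ ψ x (J t x)) μ := by
        have hU : ⋃ n : ℕ, Ioc (0 : ℝ) n = Ioi 0 :=
          iUnion_Ioc_eq_Ioi_self_iff.2 fun x _ => exists_nat_ge x
        rw [← hU, ae_restrict_iUnion_iff]
        intro n
        exact (h.integrable_apply hψ1 hψc n).prod_right_ae
      have h3 : ∀ t, (fun y => η t * ψ y) = η t • ψ := fun t => rfl
      have h4 : ∫ x, ρ 0 x * (η 0 * ψ x) ∂μ = η 0 * ∫ x, ρ 0 x * ψ x ∂μ := by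
        rw [← integral_const_mul]
        congr 1
        ext x
        ring
      simp only [h4] at h1
      refine Eq.trans ?_ h1
      congr 1
      refine integral_congr_ae ?_
      filter_upwards [h2, ae_restrict_mem measurableSet_Ioi] with t ht ht0
      have hρψ : Integrable (fun x => ρ t x * ψ x) μ := by
        obtain ⟨C, hC⟩ := hψ.continuous.bounded_above_of_compact_support hψc
        exact (h.integrable t (le_of_lt ht0)).mul_bdd hψ.continuous.aestronglyMeasurable
          (ae_of_all _ hC)
      rw [← integral_const_mul, ← integral_const_mul, ← integral_sub (hρψ.const_mul _)
        (ht.const_mul _)]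
      refine integral_congr_ae (ae_of_all _ fun x => ?_)
      simp only
      rw [deriv_mul_const (hη.differentiable (by simp)).differentiableAt,
        fderiv_const_mul (hψ.differentiable (by simp)).differentiableAt]
      simp
      ring
    · refine HasCompactSupport.intro (hηc.isCompact.prod hψc.isCompact) fun p hp => ?_
      rw [mem_prod, not_and_or] at hp
      rcases hp with hp | hp
      · rw [image_eq_zero_of_notMem_tsupport hp, zero_mul]
      · rw [image_eq_zero_of_notMem_tsupport hp, mul_zero]

/-- Mollification: a compactly supported `C¹` function is approximated in `C¹` norm by compactly
supported smooth functions. -/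
theorem exists_contDiff_approx {ψ : E → ℝ} (hψ : ContDiff ℝ 1 ψ) (hψc : HasCompactSupport ψ)
    {ε : ℝ} (hε : 0 < ε) :
    ∃ g : E → ℝ, ContDiff ℝ ∞ g ∧ HasCompactSupport g ∧ (∀ x, ‖g x - ψ x‖ ≤ ε) ∧
      ∀ x, ‖fderiv ℝ g x - fderiv ℝ ψ x‖ ≤ ε := by
  have hc' := hψ.continuous_fderiv one_ne_zero
  have hu1 := hψc.uniformContinuous_of_continuous hψ.continuous
  have hu2 := (hψc.fderiv ℝ).uniformContinuous_of_continuous hc'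
  obtain ⟨δ₁, hδ₁, h1⟩ := Metric.uniformContinuous_iff.1 hu1 ε hε
  obtain ⟨δ₂, hδ₂, h2⟩ := Metric.uniformContinuous_iff.1 hu2 ε hε
  set δ := min δ₁ δ₂
  have hδ : 0 < δ := lt_min hδ₁ hδ₂
  let φ : ContDiffBump (0 : E) := ⟨δ / 2, δ, half_pos hδ, half_lt_self hδ⟩
  have hφi : LocallyIntegrable (φ.normed (Measure.addHaar (G := E))) Measure.addHaar :=
    φ.continuous_normed.locallyIntegrable
  refine ⟨convolution (φ.normed Measure.addHaar) ψ (ContinuousLinearMap.lsmul ℝ ℝ)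
    Measure.addHaar, ?_, ?_, fun x => ?_, fun x => ?_⟩
  · exact φ.hasCompactSupport_normed.contDiff_convolution_left _ φ.contDiff_normed
      hψ.continuous.locallyIntegrable
  · exact φ.hasCompactSupport_normed.convolution _ hψc
  · rw [← dist_eq_norm]
    refine φ.dist_normed_convolution_le hψ.continuous.aestronglyMeasurable fun y hy => ?_
    exact (h1 (lt_of_lt_of_le hy (min_le_left _ _))).le
  · rw [(hψc.hasFDerivAt_convolution_right (ContinuousLinearMap.lsmul ℝ ℝ) hφi hψ x).fderiv,
      ← dist_eq_norm]
    have h3 := φ.dist_normed_convolution_le (μ := Measure.addHaar) (x₀ := x)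
      (g := fderiv ℝ ψ) (ε := ε) hc'.aestronglyMeasurable
      (fun y hy => (h2 (lt_of_lt_of_le hy (min_le_right _ _))).le)
    exact h3

/-- The integrated form of the equation for compactly supported test functions that are only
continuously differentiable. -/
theorem IsContinuityFlow.integral_sub (h : IsContinuityFlow μ ρ J) {ψ : E → ℝ}
    (hψ : ContDiff ℝ 1 ψ) (hψc : HasCompactSupport ψ) {a b : ℝ} (ha : 0 ≤ a) (hab : a ≤ b) :
    (∫ x, ρ b x * ψ x ∂μ) - ∫ x, ρ a x * ψ x ∂μ =
      -∫ s in a..b, ∫ x, fderiv ℝ ψ x (J s x) ∂μ := by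
  have hb : 0 ≤ b := ha.trans hab
  have hii : ∀ g : E → ℝ, ContDiff ℝ 1 g → HasCompactSupport g →
      IntervalIntegrable (fun s => ∫ x, fderiv ℝ g x (J s x) ∂μ) volume a b := fun g hg hgc => by
    rw [intervalIntegrable_iff_integrableOn_Ioc_of_le hab]
    exact IntegrableOn.mono_set (h.integrable_apply hg hgc b).integral_prod_left
      (Ioc_subset_Ioc_left ha)
  have hsm : ∀ g : E → ℝ, ContDiff ℝ ∞ g → HasCompactSupport g →
      (∫ x, ρ b x * g x ∂μ) - ∫ x, ρ a x * g x ∂μ =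
        -∫ s in a..b, ∫ x, fderiv ℝ g x (J s x) ∂μ := fun g hg hgc => by
    rw [h.integral_smooth hg hgc hb, h.integral_smooth hg hgc ha,
      ← intervalIntegral.integral_add_adjacent_intervals (b := a) (c := b)]
    · ring
    · rw [intervalIntegrable_iff_integrableOn_Ioc_of_le ha]
      exact (h.integrable_apply (hg.of_le (by exact_mod_cast le_top)) hgc a).integral_prod_left
    · exact hii g (hg.of_le (by exact_mod_cast le_top)) hgc
  have hmulint : ∀ t, 0 ≤ t → ∀ g : E → ℝ, Continuous g → HasCompactSupport g →
      Integrable (fun x => ρ t x * g x) μ := fun t ht g hg hgc => by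
    obtain ⟨C, hC⟩ := hg.bounded_above_of_compact_support hgc
    exact (h.integrable t ht).mul_bdd hg.aestronglyMeasurable (ae_of_all _ hC)
  set K : ℝ := (∫ x, ‖ρ b x‖ ∂μ) + (∫ x, ‖ρ a x‖ ∂μ) + ∫ s in a..b, ∫ x, ‖J s x‖ ∂μ with hK
  have hJn : IntervalIntegrable (fun s => ∫ x, ‖J s x‖ ∂μ) volume a b := by
    rw [intervalIntegrable_iff_integrableOn_Ioc_of_le hab]
    exact IntegrableOn.mono_set (h.flux_integrable b).norm.integral_prod_left
      (Ioc_subset_Ioc_left ha)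
  have hK0 : 0 ≤ K := by
    have : 0 ≤ ∫ s in a..b, ∫ x, ‖J s x‖ ∂μ :=
      intervalIntegral.integral_nonneg hab fun s _ => integral_nonneg fun x => norm_nonneg _
    have : 0 ≤ ∫ x, ‖ρ b x‖ ∂μ := integral_nonneg fun x => norm_nonneg _
    have : 0 ≤ ∫ x, ‖ρ a x‖ ∂μ := integral_nonneg fun x => norm_nonneg _
    positivity
  have hclose : ∀ ε > 0, ‖((∫ x, ρ b x * ψ x ∂μ) - ∫ x, ρ a x * ψ x ∂μ) +
      ∫ s in a..b, ∫ x, fderiv ℝ ψ x (J s x) ∂μ‖ ≤ ε * K := by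
    intro ε hε
    obtain ⟨g, hg, hgc, h0, h1⟩ := exists_contDiff_approx hψ hψc hε
    have hg1 : ContDiff ℝ 1 g := hg.of_le (by exact_mod_cast le_top)
    have hρb : ∀ t, 0 ≤ t → ‖(∫ x, ρ t x * ψ x ∂μ) - ∫ x, ρ t x * g x ∂μ‖ ≤
        ε * ∫ x, ‖ρ t x‖ ∂μ := fun t ht => by
      rw [← MeasureTheory.integral_sub (hmulint t ht ψ hψ.continuous hψc)
        (hmulint t ht g hg.continuous hgc), ← integral_const_mul]
      refine norm_integral_le_of_norm_le ((h.integrable t ht).norm.const_mul _)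
        (ae_of_all _ fun x => ?_)
      rw [← mul_sub, norm_mul, mul_comm ε, norm_sub_rev]
      exact mul_le_mul_of_nonneg_left (h0 x) (norm_nonneg _)
    have hq : ‖(∫ s in a..b, ∫ x, fderiv ℝ ψ x (J s x) ∂μ) -
        ∫ s in a..b, ∫ x, fderiv ℝ g x (J s x) ∂μ‖ ≤ ε * ∫ s in a..b, ∫ x, ‖J s x‖ ∂μ := by
      rw [← intervalIntegral.integral_sub (hii ψ hψ hψc) (hii g hg1 hgc),
        ← intervalIntegral.integral_const_mul]
      refine intervalIntegral.norm_integral_le_of_norm_le hab ?_ (hJn.const_mul ε)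
      have e1 := (h.integrable_apply hψ hψc b).prod_right_ae
      have e2 := (h.integrable_apply hg1 hgc b).prod_right_ae
      have e3 := (h.flux_integrable b).prod_right_ae
      rw [ae_restrict_iff' measurableSet_Ioc] at e1 e2 e3
      filter_upwards [e1, e2, e3] with s f1 f2 f3 hs
      have hs' : s ∈ Ioc 0 b := Ioc_subset_Ioc_left ha hs
      rw [← MeasureTheory.integral_sub (f1 hs') (f2 hs'), ← integral_const_mul]
      refine norm_integral_le_of_norm_le ((f3 hs').norm.const_mul _) (ae_of_all _ fun x => ?_)
      rw [← sub_apply]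
      refine (ContinuousLinearMap.le_opNorm _ _).trans ?_
      rw [norm_sub_rev]
      exact mul_le_mul_of_nonneg_right (h1 x) (norm_nonneg _)
    have hsplit : ((∫ x, ρ b x * ψ x ∂μ) - ∫ x, ρ a x * ψ x ∂μ) +
        ∫ s in a..b, ∫ x, fderiv ℝ ψ x (J s x) ∂μ =
        ((∫ x, ρ b x * ψ x ∂μ) - ∫ x, ρ b x * g x ∂μ)
        - ((∫ x, ρ a x * ψ x ∂μ) - ∫ x, ρ a x * g x ∂μ)
        + ((∫ s in a..b, ∫ x, fderiv ℝ ψ x (J s x) ∂μ) -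
          ∫ s in a..b, ∫ x, fderiv ℝ g x (J s x) ∂μ) := by
      have := hsm g hg hgc
      linarith
    rw [hsplit, hK, mul_add, mul_add]
    exact (norm_add_le _ _).trans
      (add_le_add ((norm_sub_le _ _).trans (add_le_add (hρb b hb) (hρb a ha))) hq)
  have hlim : Tendsto (fun ε : ℝ => ε * K) (𝓝[>] 0) (𝓝 0) := by
    have := ((continuous_id.mul continuous_const).tendsto' (0 : ℝ) (0 * K) rfl).mono_left
      (nhdsWithin_le_nhds (s := Ioi 0)) (f := fun ε : ℝ => ε * K)
    rwa [zero_mul] at this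
  have hz := ge_of_tendsto hlim (by
    filter_upwards [self_mem_nhdsWithin] with ε hε using hclose ε hε)
  have := norm_le_zero_iff.1 hz
  linarith

end WeakEquation

/-! ### Entropy decay along the continuity equation -/

section EntropyDecay

variable {E : Type*} [NormedAddCommGroup E] [NormedSpace ℝ E] [FiniteDimensional ℝ E]
  [MeasurableSpace E] [BorelSpace E]
  {μ : Measure E} [μ.IsAddHaarMeasure] {ρ : ℝ → E → ℝ} {J : ℝ → E → E}

/-- A chain rule for convex functionals of a solution. If `Ψ b` is a subgradient of `e` at time `b`
in the sense of `he`, and its derivative is jointly continuous, then the weak equation can be tested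
with `Ψ t` at time `t`: on short time intervals `Ψ` is frozen at the right end point, and the error
is the modulus of continuity of the derivative of `Ψ` times the mass of the flux. -/
theorem IsContinuityFlow.sub_le_of_subgradient (h : IsContinuityFlow μ ρ J) {Ψ : ℝ → E → ℝ}
    {K : Set E} (hK : IsCompact K) (hΨ : ∀ t, 0 ≤ t → ContDiff ℝ 1 (Ψ t))
    (hsupp : ∀ t, 0 ≤ t → ∀ x ∉ K, Ψ t x = 0)
    (hD : ContinuousOn (fun p : ℝ × E => fderiv ℝ (Ψ p.1) p.2) (Ici 0 ×ˢ univ)) {e : ℝ → ℝ}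
    (he : ∀ a b, 0 ≤ a → a ≤ b →
      e b - e a ≤ (∫ x, ρ b x * Ψ b x ∂μ) - ∫ x, ρ a x * Ψ b x ∂μ) {T : ℝ} (hT : 0 ≤ T) :
    e T - e 0 ≤ -∫ s in (0 : ℝ)..T, ∫ x, fderiv ℝ (Ψ s) x (J s x) ∂μ := by
  have hcs : ∀ t, 0 ≤ t → HasCompactSupport (Ψ t) := fun t ht =>
    HasCompactSupport.intro hK (hsupp t ht)
  have hDsupp : ∀ t, 0 ≤ t → ∀ x ∉ K, fderiv ℝ (Ψ t) x = 0 := fun t ht x hx => by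
    have : Ψ t =ᶠ[𝓝 x] fun _ => 0 := by
      filter_upwards [hK.isClosed.isOpen_compl.mem_nhds hx] with y hy using hsupp t ht y hy
    rw [this.fderiv_eq, fderiv_fun_const, Pi.zero_apply]
  have hcompact : IsCompact (Icc 0 T ×ˢ K) := isCompact_Icc.prod hK
  have hDK : ContinuousOn (fun p : ℝ × E => fderiv ℝ (Ψ p.1) p.2) (Icc 0 T ×ˢ K) :=
    hD.mono (prod_mono Icc_subset_Ici_self (subset_univ _))
  obtain ⟨C, hC⟩ := hcompact.exists_bound_of_continuousOn hDK
  have hC' : ∀ t ∈ Ioc 0 T, ∀ x, ‖fderiv ℝ (Ψ t) x‖ ≤ max C 0 := fun t ht x => by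
    by_cases hx : x ∈ K
    · exact (hC (t, x) ⟨⟨ht.1.le, ht.2⟩, hx⟩).trans (le_max_left _ _)
    · rw [hDsupp t ht.1.le x hx, norm_zero]
      exact le_max_right _ _
  have hint := integrable_clm_apply_flux (h.flux_integrable T) hD hC'
  have hJn := (h.flux_integrable T).norm
  set q : ℝ → ℝ := fun s => ∫ x, fderiv ℝ (Ψ s) x (J s x) ∂μ with hq
  set L : ℝ → ℝ := fun s => ∫ x, ‖J s x‖ ∂μ with hL
  have hsub : ∀ {a b : ℝ}, 0 ≤ a → a ≤ b → b ≤ T → Ioc a b ⊆ Ioc 0 T := fun ha _ hb =>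
    Ioc_subset_Ioc ha hb
  have hqi : ∀ a b, 0 ≤ a → a ≤ b → b ≤ T → IntervalIntegrable q volume a b :=
    fun a b ha hab hb => (intervalIntegrable_iff_integrableOn_Ioc_of_le hab).2
      (IntegrableOn.mono_set hint.integral_prod_left (hsub ha hab hb))
  have hLi : ∀ a b, 0 ≤ a → a ≤ b → b ≤ T → IntervalIntegrable L volume a b :=
    fun a b ha hab hb => (intervalIntegrable_iff_integrableOn_Ioc_of_le hab).2
      (IntegrableOn.mono_set hJn.integral_prod_left (hsub ha hab hb))
  have hstep : ∀ ε > 0, e T - e 0 + (∫ s in (0 : ℝ)..T, q s) ≤ ε * ∫ s in (0 : ℝ)..T, L s := by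
    intro ε hε
    obtain ⟨δ, hδ, hδu⟩ := Metric.uniformContinuousOn_iff.1
      (hcompact.uniformContinuousOn_of_continuous hDK) ε hε
    have hclose : ∀ s t, s ∈ Icc 0 T → t ∈ Icc 0 T → |s - t| < δ → ∀ x,
        ‖fderiv ℝ (Ψ s) x - fderiv ℝ (Ψ t) x‖ ≤ ε := fun s t hs ht hst x => by
      by_cases hx : x ∈ K
      · have := hδu (s, x) ⟨hs, hx⟩ (t, x) ⟨ht, hx⟩ (by
          rw [Prod.dist_eq, dist_self, Real.dist_eq]
          exact max_lt hst hδ)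
        rw [dist_eq_norm] at this
        exact this.le
      · rw [hDsupp s hs.1 x hx, hDsupp t ht.1 x hx, sub_zero, norm_zero]
        exact hε.le
    have hshort : ∀ a b, 0 ≤ a → a ≤ b → b ≤ T → b - a < δ →
        e b - e a + (∫ s in a..b, q s) ≤ ε * ∫ s in a..b, L s := by
      intro a b ha hab hb hba
      have hb0 := ha.trans hab
      have h1 := (he a b ha hab).trans_eq (h.integral_sub (hΨ b hb0) (hcs b hb0) ha hab)
      have hint' := h.integrable_apply (hΨ b hb0) (hcs b hb0) T
      have hqb : IntervalIntegrable (fun s => ∫ x, fderiv ℝ (Ψ b) x (J s x) ∂μ) volume a b :=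
        (intervalIntegrable_iff_integrableOn_Ioc_of_le hab).2
          (IntegrableOn.mono_set hint'.integral_prod_left (hsub ha hab hb))
      have h2 : (∫ s in a..b, q s) - ∫ s in a..b, ∫ x, fderiv ℝ (Ψ b) x (J s x) ∂μ ≤
          ε * ∫ s in a..b, L s := by
        rw [← intervalIntegral.integral_sub (hqi a b ha hab hb) hqb,
          ← intervalIntegral.integral_const_mul]
        refine (Real.le_norm_self _).trans (intervalIntegral.norm_integral_le_of_norm_le hab ?_
          ((hLi a b ha hab hb).const_mul ε))
        have e1 := hint.prod_right_ae
        have e2 := hint'.prod_right_ae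
        have e3 := (h.flux_integrable T).prod_right_ae
        rw [ae_restrict_iff' measurableSet_Ioc] at e1 e2 e3
        filter_upwards [e1, e2, e3] with s f1 f2 f3 hs
        have hs' := hsub ha hab hb hs
        rw [hq, hL]
        simp only
        rw [← MeasureTheory.integral_sub (f1 hs') (f2 hs'), ← integral_const_mul]
        refine norm_integral_le_of_norm_le ((f3 hs').norm.const_mul _) (ae_of_all _ fun x => ?_)
        rw [← sub_apply]
        refine (ContinuousLinearMap.le_opNorm _ _).trans ?_
        refine mul_le_mul_of_nonneg_right (hclose s b ⟨hs'.1.le, hs'.2⟩ ⟨hb0, hb⟩ ?_ x)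
          (norm_nonneg _)
        rw [abs_lt]
        constructor <;> linarith [hs.1, hs.2]
      linarith
    -- Sum the short-time estimate over `N` equal steps of length less than `δ`.
    obtain ⟨N, hN⟩ := exists_nat_gt (T / δ)
    have hN0 : (0 : ℝ) < N := lt_of_le_of_lt (by positivity) hN
    have hTN : T / N < δ := by
      rw [div_lt_iff₀ hN0]
      rw [div_lt_iff₀ hδ] at hN
      linarith
    have hind : ∀ n : ℕ, n ≤ N → e (n * (T / N)) - e 0 + (∫ s in (0 : ℝ)..(n * (T / N)), q s) ≤
        ε * ∫ s in (0 : ℝ)..(n * (T / N)), L s := by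
      intro n
      induction n with
      | zero => simp
      | succ n ih =>
        intro hn
        have ih' := ih (by omega)
        have p0 : 0 ≤ (n : ℝ) * (T / N) := by positivity
        have p1 : (n : ℝ) * (T / N) ≤ (n + 1 : ℕ) * (T / N) := by
          have : 0 ≤ T / N := by positivity
          push_cast
          linarith
        have p2 : ((n + 1 : ℕ) : ℝ) * (T / N) ≤ T := by
          have : ((n + 1 : ℕ) : ℝ) ≤ N := by exact_mod_cast hn
          calc ((n + 1 : ℕ) : ℝ) * (T / N) ≤ N * (T / N) := by gcongr
            _ = T := by field_simp
        have h3 := hshort _ _ p0 p1 p2 (by push_cast; linarith)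
        rw [← intervalIntegral.integral_add_adjacent_intervals
          (hqi 0 _ le_rfl p0 (p1.trans p2)) (hqi _ _ p0 p1 p2),
          ← intervalIntegral.integral_add_adjacent_intervals
          (hLi 0 _ le_rfl p0 (p1.trans p2)) (hLi _ _ p0 p1 p2)]
        linarith
    have := hind N le_rfl
    rwa [show (N : ℝ) * (T / N) = T by field_simp] at this
  have hlim : Tendsto (fun ε : ℝ => ε * ∫ s in (0 : ℝ)..T, L s) (𝓝[>] 0) (𝓝 0) := by
    have := ((continuous_id.mul continuous_const).tendsto' (0 : ℝ)
      (0 * ∫ s in (0 : ℝ)..T, L s) rfl).mono_left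
      (nhdsWithin_le_nhds (s := Ioi 0)) (f := fun ε : ℝ => ε * ∫ s in (0 : ℝ)..T, L s)
    rwa [zero_mul] at this
  have := ge_of_tendsto hlim (by
    filter_upwards [self_mem_nhdsWithin] with ε hε using hstep ε hε)
  linarith

/-- A smooth bounded truncation `M arctan (u / M)` of the identity. -/
noncomputable def truncId (M u : ℝ) : ℝ := M * Real.arctan (u / M)

/-- The convex function with derivative `truncId M (log r)` that vanishes at `r = 1`; it
increases to `InformationTheory.klFun` as `M → ∞`. -/
noncomputable def truncEntropy (M r : ℝ) : ℝ := ∫ z in (1 : ℝ)..r, truncId M (Real.log z)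

theorem hasDerivAt_truncId {M : ℝ} (hM : 0 < M) (u : ℝ) :
    HasDerivAt (truncId M) (1 + (u / M) ^ 2)⁻¹ u := by
  have h : HasDerivAt (truncId M) (M * (1 / (1 + (u / M) ^ 2) * (1 / M))) u :=
    (((hasDerivAt_id u).div_const M).arctan).const_mul M
  have h2 : (1 + (u / M) ^ 2)⁻¹ = M * (1 / (1 + (u / M) ^ 2) * (1 / M)) := by field_simp
  rwa [h2]

theorem contDiff_truncId (M : ℝ) : ContDiff ℝ 1 (truncId M) :=
  contDiff_const.mul (Real.contDiff_arctan.comp (contDiff_id.div_const M))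

theorem monotone_truncId {M : ℝ} (hM : 0 < M) : Monotone (truncId M) := fun a b hab =>
  mul_le_mul_of_nonneg_left (Real.arctan_strictMono.monotone (by gcongr)) hM.le

theorem abs_truncId_le {M : ℝ} (hM : 0 < M) (u : ℝ) : |truncId M u| ≤ M * 2 := by
  rw [truncId, abs_mul, abs_of_pos hM]
  refine mul_le_mul_of_nonneg_left (abs_le.2 ⟨?_, ?_⟩) hM.le
  · linarith [Real.neg_pi_div_two_lt_arctan (u / M), Real.pi_lt_four]
  · linarith [Real.arctan_lt_pi_div_two (u / M), Real.pi_lt_four]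

theorem truncId_zero (M : ℝ) : truncId M 0 = 0 := by simp [truncId]

theorem truncId_le {M : ℝ} (hM : 0 < M) {u : ℝ} (hu : 0 ≤ u) : truncId M u ≤ u := by
  have hd : ∀ x, HasDerivAt (fun u => u - truncId M u) (1 - (1 + (x / M) ^ 2)⁻¹) x := fun x =>
    (hasDerivAt_id x).sub (hasDerivAt_truncId hM x)
  have h := monotone_of_deriv_nonneg (fun x => (hd x).differentiableAt) (fun x => by
    rw [(hd x).deriv, sub_nonneg]
    exact inv_le_one_of_one_le₀ (by nlinarith [sq_nonneg (x / M)])) hu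
  simp only [truncId_zero] at h
  linarith

theorem le_truncId {M : ℝ} (hM : 0 < M) {u : ℝ} (hu : u ≤ 0) : u ≤ truncId M u := by
  have h := truncId_le hM (neg_nonneg.2 hu)
  have h2 : truncId M (-u) = -truncId M u := by
    rw [truncId, truncId, neg_div, Real.arctan_neg, mul_neg]
  linarith

theorem continuousOn_truncId_log (M : ℝ) :
    ContinuousOn (fun z => truncId M (Real.log z)) (Ioi 0) :=
  (contDiff_truncId M).continuous.comp_continuousOn
    (Real.continuousOn_log.mono fun _ hz => ne_of_gt hz)

theorem intervalIntegrable_truncId_log (M : ℝ) {a b : ℝ} (ha : 0 < a) (hb : 0 < b) :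
    IntervalIntegrable (fun z => truncId M (Real.log z)) volume a b := by
  refine ((continuousOn_truncId_log M).mono fun z hz => ?_).intervalIntegrable
  exact lt_of_lt_of_le (lt_min ha hb) hz.1

/-- The tangent line inequality for the convex function `truncEntropy M`. -/
theorem truncEntropy_sub_le {M : ℝ} (hM : 0 < M) {a b : ℝ} (ha : 0 < a) (hb : 0 < b) :
    truncEntropy M b - truncEntropy M a ≤ truncId M (Real.log b) * (b - a) := by
  rw [truncEntropy, truncEntropy, intervalIntegral.integral_interval_sub_left
    (intervalIntegrable_truncId_log M one_pos hb) (intervalIntegrable_truncId_log M one_pos ha)]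
  rcases le_total a b with hab | hab
  · have := intervalIntegral.integral_mono_on hab (intervalIntegrable_truncId_log M ha hb)
      (intervalIntegrable_const (c := truncId M (Real.log b))) fun x hx =>
        monotone_truncId hM (Real.log_le_log (ha.trans_le hx.1) hx.2)
    rw [intervalIntegral.integral_const, smul_eq_mul] at this
    linarith
  · have := intervalIntegral.integral_mono_on hab
      (intervalIntegrable_const (c := truncId M (Real.log b)))
      (intervalIntegrable_truncId_log M hb ha) fun x hx =>
        monotone_truncId hM (Real.log_le_log hb hx.1)
    rw [intervalIntegral.integral_const, smul_eq_mul] at this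
    rw [intervalIntegral.integral_symm]
    linarith

theorem truncEntropy_nonneg {M : ℝ} (hM : 0 < M) {r : ℝ} (hr : 0 < r) : 0 ≤ truncEntropy M r := by
  have h := truncEntropy_sub_le hM hr one_pos
  rw [Real.log_one, truncId_zero, zero_mul] at h
  have h1 : truncEntropy M 1 = 0 := intervalIntegral.integral_same
  linarith

theorem truncEntropy_le_klFun {M : ℝ} (hM : 0 < M) {r : ℝ} (hr : 0 < r) :
    truncEntropy M r ≤ InformationTheory.klFun r := by
  have hlog : ∫ z in (1 : ℝ)..r, Real.log z = InformationTheory.klFun r := by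
    rw [integral_log, InformationTheory.klFun, Real.log_one]
    ring
  have hi := intervalIntegrable_truncId_log M one_pos hr
  have hi' : IntervalIntegrable Real.log volume 1 r := intervalIntegral.intervalIntegrable_log'
  rw [← hlog, truncEntropy]
  rcases le_total 1 r with h | h
  · exact intervalIntegral.integral_mono_on h hi hi' fun x hx =>
      truncId_le hM (Real.log_nonneg hx.1)
  · rw [intervalIntegral.integral_symm, intervalIntegral.integral_symm r 1, neg_le_neg_iff]
    exact intervalIntegral.integral_mono_on h hi'.symm hi.symm fun x hx =>
      le_truncId hM (Real.log_nonpos (hr.le.trans hx.1) hx.2)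

theorem continuousOn_truncEntropy (M : ℝ) : ContinuousOn (truncEntropy M) (Ioi 0) := by
  intro r hr
  have hr' : (0 : ℝ) < r := hr
  refine (intervalIntegral.integral_hasDerivAt_right
    (intervalIntegrable_truncId_log M one_pos hr') ?_ ?_).continuousAt.continuousWithinAt
  · exact (continuousOn_truncId_log M).stronglyMeasurableAtFilter isOpen_Ioi r hr
  · exact (continuousOn_truncId_log M).continuousAt (Ioi_mem_nhds hr')

end EntropyDecay

section Dissipation

variable {E : Type*} [NormedAddCommGroup E] [NormedSpace ℝ E]

theorem hasFDerivAt_log_div {ρ π : E → ℝ} {x : E} (hρ : DifferentiableAt ℝ ρ x)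
    (hπ : DifferentiableAt ℝ π x) (hρx : 0 < ρ x) (hπx : 0 < π x) :
    HasFDerivAt (fun y => Real.log (ρ y / π y))
      ((ρ x)⁻¹ • fderiv ℝ ρ x - (π x)⁻¹ • fderiv ℝ π x) x := by
  have h := (hρ.hasFDerivAt.log hρx.ne').sub (hπ.hasFDerivAt.log hπx.ne')
  refine h.congr_of_eventuallyEq ?_
  filter_upwards [hρ.continuousAt.eventually_ne hρx.ne', hπ.continuousAt.eventually_ne hπx.ne']
    with y h1 h2
  exact Real.log_div h1 h2

theorem continuousOn_log_div {E : Type*} [TopologicalSpace E] {ρ : ℝ → E → ℝ} {π : E → ℝ}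
    (hc : ContinuousOn (Function.uncurry ρ) (Ici 0 ×ˢ univ))
    (hpos : ∀ t, 0 ≤ t → ∀ x, 0 < ρ t x) (hπ : Continuous π) (hπpos : ∀ x, 0 < π x) :
    ContinuousOn (fun p : ℝ × E => Real.log (ρ p.1 p.2 / π p.2)) (Ici 0 ×ˢ univ) := by
  refine ContinuousOn.log (hc.div (hπ.comp continuous_snd).continuousOn
    fun p _ => (hπpos p.2).ne') fun p hp => ?_
  exact (div_pos (hpos p.1 hp.1 p.2) (hπpos p.2)).ne'

theorem continuousOn_fderiv_log_div {ρ : ℝ → E → ℝ} {π : E → ℝ}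
    (hc : ContinuousOn (Function.uncurry ρ) (Ici 0 ×ˢ univ))
    (hpos : ∀ t, 0 ≤ t → ∀ x, 0 < ρ t x) (hd : ∀ t, 0 ≤ t → ContDiff ℝ 1 (ρ t))
    (hD : ContinuousOn (fun p : ℝ × E => fderiv ℝ (ρ p.1) p.2) (Ici 0 ×ˢ univ))
    (hπ : ContDiff ℝ 1 π) (hπpos : ∀ x, 0 < π x) :
    ContinuousOn (fun p : ℝ × E => fderiv ℝ (fun y => Real.log (ρ p.1 y / π y)) p.2)
      (Ici 0 ×ˢ univ) := by
  have h1 : ContinuousOn (fun p : ℝ × E => (ρ p.1 p.2)⁻¹ • fderiv ℝ (ρ p.1) p.2 -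
      (π p.2)⁻¹ • fderiv ℝ π p.2) (Ici 0 ×ˢ univ) := by
    refine ((hc.inv₀ fun p hp => (hpos p.1 hp.1 p.2).ne').smul hD).sub
      (Continuous.continuousOn ?_)
    exact ((hπ.continuous.comp continuous_snd).inv₀ fun p => (hπpos p.2).ne').smul
      ((hπ.continuous_fderiv one_ne_zero).comp continuous_snd)
  refine h1.congr fun p hp => ?_
  exact (hasFDerivAt_log_div ((hd p.1 hp.1).differentiable one_ne_zero).differentiableAt
    (hπ.differentiable one_ne_zero).differentiableAt (hpos p.1 hp.1 p.2) (hπpos p.2)).fderiv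

theorem fderiv_cutoff_mul_truncId {χ u : E → ℝ} (hχ : ContDiff ℝ 1 χ) {x : E}
    (hu : DifferentiableAt ℝ u x) {M : ℝ} (hM : 0 < M) :
    fderiv ℝ (fun y => χ y * truncId M (u y)) x =
      χ x • (1 + (u x / M) ^ 2)⁻¹ • fderiv ℝ u x + truncId M (u x) • fderiv ℝ χ x :=
  ((hχ.differentiable one_ne_zero).differentiableAt.hasFDerivAt.mul
    ((hasDerivAt_truncId hM (u x)).comp_hasFDerivAt x hu.hasFDerivAt)).fderiv

variable [FiniteDimensional ℝ E] [MeasurableSpace E] [BorelSpace E]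
  {μ : Measure E} [μ.IsAddHaarMeasure] {ρ : ℝ → E → ℝ} {J : ℝ → E → E} {π : E → ℝ}

/-- The truncated dissipation is bounded by the initial entropy, up to the error that the cutoff
`χ` produces. -/
theorem IsContinuityFlow.truncated_dissipation_le (h : IsContinuityFlow μ ρ J)
    (hpos : ∀ t, 0 ≤ t → ∀ x, 0 < ρ t x) (hd : ∀ t, 0 ≤ t → ContDiff ℝ 1 (ρ t))
    (hD : ContinuousOn (fun p : ℝ × E => fderiv ℝ (ρ p.1) p.2) (Ici 0 ×ˢ univ))
    (hπ : ContDiff ℝ 1 π) (hπpos : ∀ x, 0 < π x)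
    (hent : Integrable (fun x => π x * InformationTheory.klFun (ρ 0 x / π x)) μ)
    {χ : E → ℝ} (hχ : ContDiff ℝ 1 χ) (hχc : HasCompactSupport χ) (hχ0 : ∀ x, 0 ≤ χ x)
    (hχ1 : ∀ x, χ x ≤ 1) {C : ℝ} (hC : ∀ x, ‖fderiv ℝ χ x‖ ≤ C) {M : ℝ} (hM : 0 < M)
    {T : ℝ} (hT : 0 ≤ T) :
    Integrable (fun p : ℝ × E => χ p.2 * (1 + (Real.log (ρ p.1 p.2 / π p.2) / M) ^ 2)⁻¹ *
      fderiv ℝ (fun y => Real.log (ρ p.1 y / π y)) p.2 (J p.1 p.2))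
      ((volume.restrict (Ioc 0 T)).prod μ) ∧
    ∫ p : ℝ × E, χ p.2 * (1 + (Real.log (ρ p.1 p.2 / π p.2) / M) ^ 2)⁻¹ *
      fderiv ℝ (fun y => Real.log (ρ p.1 y / π y)) p.2 (J p.1 p.2)
      ∂((volume.restrict (Ioc 0 T)).prod μ) ≤
    (∫ x, π x * InformationTheory.klFun (ρ 0 x / π x) ∂μ) +
      M * 2 * C * ∫ p, ‖Function.uncurry J p‖ ∂((volume.restrict (Ioc 0 T)).prod μ) := by
  set K := tsupport χ with hKdef
  have hK : IsCompact K := hχc.isCompact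
  set u : ℝ → E → ℝ := fun t x => Real.log (ρ t x / π x) with hu
  have huc : ContinuousOn (fun p : ℝ × E => u p.1 p.2) (Ici 0 ×ˢ univ) :=
    continuousOn_log_div h.continuous hpos hπ.continuous hπpos
  have hDu : ContinuousOn (fun p : ℝ × E => fderiv ℝ (u p.1) p.2) (Ici 0 ×ˢ univ) :=
    continuousOn_fderiv_log_div h.continuous hpos hd hD hπ hπpos
  have hud : ∀ t, 0 ≤ t → ContDiff ℝ 1 (u t) := fun t ht =>
    ((hd t ht).div hπ fun x => (hπpos x).ne').log fun x => (div_pos (hpos t ht x) (hπpos x)).ne'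
  set A : ℝ × E → E →L[ℝ] ℝ := fun p =>
    χ p.2 • (1 + (u p.1 p.2 / M) ^ 2)⁻¹ • fderiv ℝ (u p.1) p.2 with hA
  set B : ℝ × E → E →L[ℝ] ℝ := fun p => truncId M (u p.1 p.2) • fderiv ℝ χ p.2 with hB
  have hAc : ContinuousOn A (Ici 0 ×ˢ univ) := by
    have h1 : ContinuousOn (fun p : ℝ × E => (1 + (u p.1 p.2 / M) ^ 2)⁻¹) (Ici 0 ×ˢ univ) :=
      (continuousOn_const.add ((huc.div_const M).pow 2)).inv₀ fun p _ =>
        (show (0 : ℝ) < 1 + (u p.1 p.2 / M) ^ 2 by positivity).ne'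
    exact (hχ.continuous.comp continuous_snd).continuousOn.smul (h1.smul hDu)
  have hBc : ContinuousOn B (Ici 0 ×ˢ univ) :=
    ((contDiff_truncId M).continuous.comp_continuousOn huc).smul
      ((hχ.continuous_fderiv one_ne_zero).comp continuous_snd).continuousOn
  have hC0 : 0 ≤ C := (norm_nonneg _).trans (hC 0)
  have hBb : ∀ p, ‖B p‖ ≤ M * 2 * C := fun p => by
    rw [hB, norm_smul, Real.norm_eq_abs]
    exact mul_le_mul (abs_truncId_le hM _) (hC _) (norm_nonneg _) (by positivity)
  obtain ⟨CA, hCA⟩ := (isCompact_Icc.prod hK).exists_bound_of_continuousOn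
    (hAc.mono (prod_mono (show Icc (0 : ℝ) T ⊆ Ici 0 from Icc_subset_Ici_self) (subset_univ K)))
  have hAb : ∀ t ∈ Ioc 0 T, ∀ x, ‖A (t, x)‖ ≤ max CA 0 := fun t ht x => by
    by_cases hx : x ∈ K
    · exact (hCA (t, x) ⟨⟨ht.1.le, ht.2⟩, hx⟩).trans (le_max_left _ _)
    · have : A (t, x) = 0 := by
        rw [hA]
        simp only
        rw [image_eq_zero_of_notMem_tsupport hx, zero_smul]
      rw [this, norm_zero]
      exact le_max_right _ _
  have hAi := integrable_clm_apply_flux (h.flux_integrable T) hAc hAb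
  have hBi := integrable_clm_apply_flux (h.flux_integrable T) hBc (fun t _ x => hBb (t, x))
  set Ψ : ℝ → E → ℝ := fun t x => χ x * truncId M (u t x) with hΨ
  have hΨD : ∀ t, 0 ≤ t → ∀ x, fderiv ℝ (Ψ t) x = A (t, x) + B (t, x) := fun t ht x =>
    fderiv_cutoff_mul_truncId hχ ((hud t ht).differentiable one_ne_zero).differentiableAt hM
  set e : ℝ → ℝ := fun t => ∫ x, χ x * (π x * truncEntropy M (ρ t x / π x)) ∂μ with he
  have hei : ∀ t, 0 ≤ t → Integrable (fun x => χ x * (π x * truncEntropy M (ρ t x / π x))) μ :=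
    fun t ht => by
      refine Continuous.integrable_of_hasCompactSupport ?_ hχc.mul_right
      refine hχ.continuous.mul (hπ.continuous.mul ?_)
      exact (continuousOn_truncEntropy M).comp_continuous
        ((hd t ht).continuous.div hπ.continuous fun x => (hπpos x).ne')
        fun x => div_pos (hpos t ht x) (hπpos x)
  have hΨd : ∀ t, 0 ≤ t → ContDiff ℝ 1 (Ψ t) := fun t ht =>
    hχ.mul ((contDiff_truncId M).comp (hud t ht))
  have hρΨ : ∀ a b, 0 ≤ a → 0 ≤ b → Integrable (fun x => ρ a x * Ψ b x) μ := fun a b ha hb =>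
    Continuous.integrable_of_hasCompactSupport ((hd a ha).continuous.mul (hΨd b hb).continuous)
      (HasCompactSupport.mul_left hχc.mul_right)
  have hmain := h.sub_le_of_subgradient hK hΨd
    (fun t _ x hx => by
      rw [hΨ]
      simp only
      rw [image_eq_zero_of_notMem_tsupport hx, zero_mul])
    ((hAc.add hBc).congr fun p hp => hΨD p.1 hp.1 p.2) (e := e) (fun a b ha hab => by
      have hb := ha.trans hab
      rw [← MeasureTheory.integral_sub (hei b hb) (hei a ha),
        ← MeasureTheory.integral_sub (hρΨ b b hb hb) (hρΨ a b ha hb)]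
      refine integral_mono ((hei b hb).sub (hei a ha)) ((hρΨ b b hb hb).sub (hρΨ a b ha hb))
        fun x => ?_
      have h1 := truncEntropy_sub_le hM (div_pos (hpos a ha x) (hπpos x))
        (div_pos (hpos b hb x) (hπpos x))
      have h2 := mul_le_mul_of_nonneg_left h1 (mul_nonneg (hχ0 x) (hπpos x).le)
      have h3 : χ x * π x * (truncId M (Real.log (ρ b x / π x)) *
          (ρ b x / π x - ρ a x / π x)) = ρ b x * Ψ b x - ρ a x * Ψ b x := by
        simp only [hΨ, hu]
        have := (hπpos x).ne'
        field_simp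
      simp only
      rw [← h3]
      linarith) hT
  have hfub : ∫ s in (0 : ℝ)..T, ∫ x, fderiv ℝ (Ψ s) x (J s x) ∂μ =
      (∫ p, A p (J p.1 p.2) ∂((volume.restrict (Ioc 0 T)).prod μ)) +
      ∫ p, B p (J p.1 p.2) ∂((volume.restrict (Ioc 0 T)).prod μ) := by
    have hAB : Integrable (fun p : ℝ × E => A p (J p.1 p.2) + B p (J p.1 p.2))
        ((volume.restrict (Ioc 0 T)).prod μ) := hAi.add hBi
    rw [← integral_add hAi hBi, integral_prod _ hAB, intervalIntegral.integral_of_le hT]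
    refine setIntegral_congr_fun measurableSet_Ioc fun s hs => ?_
    simp only
    congr 1
    ext x
    rw [hΨD s hs.1.le x, add_apply]
  have heT : 0 ≤ e T := integral_nonneg fun x => mul_nonneg (hχ0 x) (mul_nonneg (hπpos x).le
    (truncEntropy_nonneg hM (div_pos (hpos T hT x) (hπpos x))))
  have he0 : e 0 ≤ ∫ x, π x * InformationTheory.klFun (ρ 0 x / π x) ∂μ := by
    refine integral_mono (hei 0 le_rfl) hent fun x => ?_
    have hr := div_pos (hpos 0 le_rfl x) (hπpos x)
    have h0 := mul_nonneg (hπpos x).le (truncEntropy_nonneg hM hr)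
    refine (mul_le_of_le_one_left h0 (hχ1 x)).trans ?_
    exact mul_le_mul_of_nonneg_left (truncEntropy_le_klFun hM hr) (hπpos x).le
  have hBle : -∫ p, B p (J p.1 p.2) ∂((volume.restrict (Ioc 0 T)).prod μ) ≤
      M * 2 * C * ∫ p, ‖Function.uncurry J p‖ ∂((volume.restrict (Ioc 0 T)).prod μ) := by
    refine (neg_le_abs _).trans ?_
    rw [← integral_const_mul, ← Real.norm_eq_abs]
    refine norm_integral_le_of_norm_le ((h.flux_integrable T).norm.const_mul _)
      (ae_of_all _ fun p => ?_)
    exact (ContinuousLinearMap.le_opNorm _ _).trans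
      (mul_le_mul_of_nonneg_right (hBb p) (norm_nonneg _))
  have hAeq : (fun p : ℝ × E => χ p.2 * (1 + (u p.1 p.2 / M) ^ 2)⁻¹ *
      fderiv ℝ (u p.1) p.2 (J p.1 p.2)) = fun p => A p (J p.1 p.2) := by
    ext p
    simp only [hA, smul_apply, smul_eq_mul]
    ring
  change Integrable (fun p : ℝ × E => χ p.2 * (1 + (u p.1 p.2 / M) ^ 2)⁻¹ *
      fderiv ℝ (u p.1) p.2 (J p.1 p.2)) _ ∧ ∫ p : ℝ × E, χ p.2 * (1 + (u p.1 p.2 / M) ^ 2)⁻¹ *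
      fderiv ℝ (u p.1) p.2 (J p.1 p.2) ∂_ ≤ _
  rw [hAeq]
  refine ⟨hAi, ?_⟩
  rw [hfub] at hmain
  linarith

/-- Smooth cutoffs that exhaust the space and whose derivatives decay quadratically. -/
theorem exists_cutoff_sequence (E : Type*) [NormedAddCommGroup E] [NormedSpace ℝ E]
    [FiniteDimensional ℝ E] :
    ∃ (χ : ℕ → E → ℝ) (C : ℝ), (∀ n, ContDiff ℝ 1 (χ n)) ∧ (∀ n, HasCompactSupport (χ n)) ∧
      (∀ n x, 0 ≤ χ n x) ∧ (∀ n x, χ n x ≤ 1) ∧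
      (∀ n x, ‖fderiv ℝ (χ n) x‖ ≤ C / ((n : ℝ) + 1) ^ 2) ∧
      ∀ x, Tendsto (fun n => χ n x) atTop (𝓝 1) := by
  let φ : ContDiffBump (0 : E) := ⟨1, 2, one_pos, one_lt_two⟩
  have hφ : ContDiff ℝ 1 φ := φ.contDiff
  obtain ⟨C, hC⟩ := (hφ.continuous_fderiv one_ne_zero).bounded_above_of_compact_support
    (φ.hasCompactSupport.fderiv ℝ)
  have hr : ∀ n : ℕ, 0 < (((n : ℝ) + 1) ^ 2)⁻¹ := fun n => by positivity
  have hder : ∀ (n : ℕ) (x : E), HasFDerivAt (fun x => φ ((((n : ℝ) + 1) ^ 2)⁻¹ • x))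
      ((fderiv ℝ φ ((((n : ℝ) + 1) ^ 2)⁻¹ • x)).comp
        ((((n : ℝ) + 1) ^ 2)⁻¹ • ContinuousLinearMap.id ℝ E)) x := fun n x =>
    (hφ.differentiable one_ne_zero).differentiableAt.hasFDerivAt.comp x
      ((hasFDerivAt_id x).const_smul _)
  refine ⟨fun n x => φ ((((n : ℝ) + 1) ^ 2)⁻¹ • x), C, fun n => hφ.comp (contDiff_const_smul _),
    fun n => ?_, fun n x => φ.nonneg, fun n x => φ.le_one, fun n x => ?_, fun x => ?_⟩
  · exact φ.hasCompactSupport.comp_homeomorph (Homeomorph.smulOfNeZero _ (hr n).ne')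
  · rw [(hder n x).fderiv, ContinuousLinearMap.comp_smul, ContinuousLinearMap.comp_id, norm_smul,
      Real.norm_of_nonneg (hr n).le, div_eq_inv_mul]
    exact mul_le_mul_of_nonneg_left (hC _) (hr n).le
  · obtain ⟨N, hN⟩ := exists_nat_ge ‖x‖
    refine tendsto_const_nhds.congr' ?_
    filter_upwards [eventually_ge_atTop N] with n hn
    refine (φ.one_of_mem_closedBall ?_).symm
    rw [mem_closedBall_zero_iff, norm_smul, Real.norm_of_nonneg (hr n).le, inv_mul_le_iff₀
      (by positivity), mul_one]
    have h1 : (N : ℝ) ≤ n := by exact_mod_cast hn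
    have h2 : (0 : ℝ) ≤ N := N.cast_nonneg
    nlinarith

/-- The entropy dissipation inequality. If the dissipation density is bounded below by an
integrable function, the truncations and cutoffs can be removed by Fatou's lemma. -/
theorem IsContinuityFlow.dissipation_le (h : IsContinuityFlow μ ρ J)
    (hpos : ∀ t, 0 ≤ t → ∀ x, 0 < ρ t x) (hd : ∀ t, 0 ≤ t → ContDiff ℝ 1 (ρ t))
    (hD : ContinuousOn (fun p : ℝ × E => fderiv ℝ (ρ p.1) p.2) (Ici 0 ×ˢ univ))
    (hπ : ContDiff ℝ 1 π) (hπpos : ∀ x, 0 < π x)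
    (hent : Integrable (fun x => π x * InformationTheory.klFun (ρ 0 x / π x)) μ)
    {T : ℝ} (hT : 0 ≤ T) {W : ℝ × E → ℝ} (hW : Integrable W ((volume.restrict (Ioc 0 T)).prod μ))
    (hWG : ∀ᵐ p ∂((volume.restrict (Ioc 0 T)).prod μ), 0 ≤ W p ∧
      -W p ≤ fderiv ℝ (fun y => Real.log (ρ p.1 y / π y)) p.2 (J p.1 p.2)) :
    Integrable (fun p : ℝ × E => fderiv ℝ (fun y => Real.log (ρ p.1 y / π y)) p.2 (J p.1 p.2))
      ((volume.restrict (Ioc 0 T)).prod μ) ∧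
    ∫ p : ℝ × E, fderiv ℝ (fun y => Real.log (ρ p.1 y / π y)) p.2 (J p.1 p.2)
      ∂((volume.restrict (Ioc 0 T)).prod μ) ≤
      ∫ x, π x * InformationTheory.klFun (ρ 0 x / π x) ∂μ := by
  obtain ⟨χ, C, hχ, hχc, hχ0, hχ1, hχD, hχl⟩ := exists_cutoff_sequence E
  set κ := (volume.restrict (Ioc 0 T)).prod μ with hκ
  set u : ℝ → E → ℝ := fun t x => Real.log (ρ t x / π x) with hu
  set G : ℝ × E → ℝ := fun p => fderiv ℝ (u p.1) p.2 (J p.1 p.2) with hG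
  set S : ℝ := ∫ x, π x * InformationTheory.klFun (ρ 0 x / π x) ∂μ with hS
  set N : ℝ := ∫ p, ‖Function.uncurry J p‖ ∂κ with hN
  -- Truncation at height `n + 1` with a cutoff of slope `O((n + 1)⁻²)`: the cutoff error is
  -- `O((n + 1)⁻¹)`.
  set θ : ℕ → ℝ × E → ℝ := fun n p =>
    χ n p.2 * (1 + (u p.1 p.2 / ((n : ℝ) + 1)) ^ 2)⁻¹ with hθ
  have hstep : ∀ n : ℕ, Integrable (fun p => θ n p * G p) κ ∧
      ∫ p, θ n p * G p ∂κ ≤ S + ((n : ℝ) + 1) * 2 * (C / ((n : ℝ) + 1) ^ 2) * N := fun n =>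
    h.truncated_dissipation_le hpos hd hD hπ hπpos hent (hχ n) (hχc n) (hχ0 n) (hχ1 n) (hχD n)
      (by positivity) hT
  have hθ0 : ∀ n p, 0 ≤ θ n p := fun n p => mul_nonneg (hχ0 n _) (by positivity)
  have hθ1 : ∀ n p, θ n p ≤ 1 := fun n p => by
    refine mul_le_one₀ (hχ1 n _) (by positivity) (inv_le_one_of_one_le₀ ?_)
    have : 0 ≤ (u p.1 p.2 / ((n : ℝ) + 1)) ^ 2 := sq_nonneg _
    linarith
  have hθl : ∀ p, Tendsto (fun n => θ n p) atTop (𝓝 1) := fun p => by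
    have h1 : Tendsto (fun n : ℕ => u p.1 p.2 / ((n : ℝ) + 1)) atTop (𝓝 0) := by
      have := tendsto_one_div_add_atTop_nhds_zero_nat (𝕜 := ℝ).const_mul (u p.1 p.2)
      simpa [div_eq_mul_inv] using this
    have h2 := (hχl p.2).mul ((((h1.pow 2).const_add 1)).inv₀ (by norm_num))
    simpa using h2
  have hnn : ∀ n, 0 ≤ᵐ[κ] fun p => θ n p * G p + W p := fun n => by
    filter_upwards [hWG] with p hp
    -- `θ G + W = θ (G + W) + (1 - θ) W`.
    have h1 : 0 ≤ θ n p * (G p + W p) := mul_nonneg (hθ0 n p) (by linarith [hp.2])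
    have h2 : 0 ≤ (1 - θ n p) * W p := mul_nonneg (by linarith [hθ1 n p]) hp.1
    change 0 ≤ θ n p * G p + W p
    linarith
  have hGm : AEStronglyMeasurable G κ := by
    refine aestronglyMeasurable_of_tendsto_ae atTop (fun n => (hstep n).1.1)
      (ae_of_all _ fun p => ?_)
    simpa using (hθl p).mul_const (G p)
  have hfatou : ∫⁻ p, ENNReal.ofReal (G p + W p) ∂κ ≤ ENNReal.ofReal (S + ∫ p, W p ∂κ) := by
    have hlim : ∀ p, liminf (fun n => ENNReal.ofReal (θ n p * G p + W p)) atTop =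
        ENNReal.ofReal (G p + W p) := fun p => by
      refine Tendsto.liminf_eq ((ENNReal.continuous_ofReal.tendsto _).comp ?_)
      simpa using ((hθl p).mul_const (G p)).add_const (W p)
    calc ∫⁻ p, ENNReal.ofReal (G p + W p) ∂κ
        = ∫⁻ p, liminf (fun n => ENNReal.ofReal (θ n p * G p + W p)) atTop ∂κ := by
          simp only [hlim]
      _ ≤ liminf (fun n => ∫⁻ p, ENNReal.ofReal (θ n p * G p + W p) ∂κ) atTop :=
          lintegral_liminf_le' fun n =>
            ((hstep n).1.add hW).1.aemeasurable.ennreal_ofReal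
      _ ≤ liminf (fun n : ℕ => ENNReal.ofReal
            (S + ((n : ℝ) + 1) * 2 * (C / ((n : ℝ) + 1) ^ 2) * N + ∫ p, W p ∂κ)) atTop := by
          refine liminf_le_liminf (Eventually.of_forall fun n => ?_)
          have hi : Integrable (fun p => θ n p * G p + W p) κ := (hstep n).1.add hW
          rw [← ofReal_integral_eq_lintegral_ofReal hi (hnn n),
            integral_add (hstep n).1 hW]
          exact ENNReal.ofReal_le_ofReal (by linarith [(hstep n).2])
      _ = ENNReal.ofReal (S + ∫ p, W p ∂κ) := by
          refine Tendsto.liminf_eq ((ENNReal.continuous_ofReal.tendsto _).comp ?_)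
          refine Tendsto.add_const _ ?_
          have h1 : Tendsto (fun n : ℕ => 2 * C * N * (1 / ((n : ℝ) + 1))) atTop
              (𝓝 (2 * C * N * 0)) :=
            tendsto_one_div_add_atTop_nhds_zero_nat.const_mul _
          have h2 := h1.const_add S
          rw [mul_zero, add_zero] at h2
          refine h2.congr fun n => ?_
          have : (n : ℝ) + 1 ≠ 0 := by positivity
          field_simp
  have hGW0 : 0 ≤ᵐ[κ] fun p => G p + W p := by
    filter_upwards [hWG] with p hp
    change 0 ≤ G p + W p
    linarith [hp.2]
  have hGWi : Integrable (fun p => G p + W p) κ := by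
    refine ⟨hGm.add hW.1, ?_⟩
    rw [hasFiniteIntegral_iff_ofReal hGW0]
    exact hfatou.trans_lt ENNReal.ofReal_lt_top
  have hGi : Integrable G κ := by
    refine (hGWi.sub hW).congr (ae_of_all _ fun p => ?_)
    simp
  refine ⟨hGi, ?_⟩
  rw [← ofReal_integral_eq_lintegral_ofReal hGWi hGW0, integral_add hGi hW] at hfatou
  have hS0 : 0 ≤ S := integral_nonneg fun x => mul_nonneg (hπpos x).le
    (InformationTheory.klFun_nonneg (div_pos (hpos 0 le_rfl x) (hπpos x)).le)
  have hW0 : 0 ≤ ∫ p, W p ∂κ := integral_nonneg_of_ae (by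
    filter_upwards [hWG] with p hp using hp.1)
  have := (ENNReal.ofReal_le_ofReal_iff (by linarith)).1 hfatou
  linarith

end Dissipation

/-! ### Density measures, scores and the entropy -/

section Densities

variable {d : ℕ}

theorem inner_gradient_eq_fderiv (f : EuclideanSpace ℝ (Fin d) → ℝ)
    (x y : EuclideanSpace ℝ (Fin d)) : ⟪gradient f x, y⟫ = fderiv ℝ f x y :=
  InnerProductSpace.toDual_symm_apply

theorem lintegral_densityMeasure {ρ : EuclideanSpace ℝ (Fin d) → ℝ} (hρ : Continuous ρ)
    (f : EuclideanSpace ℝ (Fin d) → ℝ≥0∞) :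
    ∫⁻ x, f x ∂(densityMeasure ρ) = ∫⁻ x, ENNReal.ofReal (ρ x) * f x := by
  rw [densityMeasure, lintegral_withDensity_eq_lintegral_mul_non_measurable _
    hρ.measurable.ennreal_ofReal (ae_of_all _ fun _ => ENNReal.ofReal_lt_top)]
  rfl

theorem integral_densityMeasure {ρ : EuclideanSpace ℝ (Fin d) → ℝ} (hρ : Continuous ρ)
    (hpos : ∀ x, 0 < ρ x) (f : EuclideanSpace ℝ (Fin d) → ℝ) :
    ∫ x, f x ∂(densityMeasure ρ) = ∫ x, ρ x * f x := by
  rw [densityMeasure, integral_withDensity_eq_integral_toReal_smul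
    hρ.measurable.ennreal_ofReal (ae_of_all _ fun _ => ENNReal.ofReal_lt_top)]
  simp only [ENNReal.toReal_ofReal (hpos _).le, smul_eq_mul]

theorem IsSmoothDensity.isProbabilityMeasure {ρ : EuclideanSpace ℝ (Fin d) → ℝ}
    (hρ : IsSmoothDensity ρ) : IsProbabilityMeasure (densityMeasure ρ) := by
  constructor
  rw [densityMeasure, withDensity_apply _ MeasurableSet.univ, Measure.restrict_univ,
    ← ofReal_integral_eq_lintegral_ofReal hρ.integrable (ae_of_all _ fun x => (hρ.pos x).le),
    hρ.integral_eq_one, ENNReal.ofReal_one]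

theorem densityMeasure_eq_withDensity {ρ π : EuclideanSpace ℝ (Fin d) → ℝ} (hρ : Continuous ρ)
    (hπ : Continuous π) (hπpos : ∀ x, 0 < π x) :
    densityMeasure ρ = (densityMeasure π).withDensity fun x => ENNReal.ofReal (ρ x / π x) := by
  rw [densityMeasure, densityMeasure, ← withDensity_mul _ hπ.measurable.ennreal_ofReal
    (f := fun x => ENNReal.ofReal (π x)) (g := fun x => ENNReal.ofReal (ρ x / π x))
    (hρ.div₀ hπ fun x => (hπpos x).ne').measurable.ennreal_ofReal]
  congr 1
  ext x
  rw [Pi.mul_apply, ← ENNReal.ofReal_mul (hπpos x).le, mul_div_cancel₀ _ (hπpos x).ne']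

/-- The Kullback–Leibler divergence of two positive continuous densities. -/
theorem klDiv_densityMeasure {ρ π : EuclideanSpace ℝ (Fin d) → ℝ} (hρ : IsSmoothDensity ρ)
    (hπ : IsSmoothDensity π) :
    InformationTheory.klDiv (densityMeasure ρ) (densityMeasure π) =
      ∫⁻ x, ENNReal.ofReal (π x * InformationTheory.klFun (ρ x / π x)) := by
  have hρc := hρ.contDiff.continuous
  have hπc := hπ.contDiff.continuous
  have := hρ.isProbabilityMeasure
  have := hπ.isProbabilityMeasure
  have heq := densityMeasure_eq_withDensity hρc hπc hπ.pos
  have hac : densityMeasure ρ ≪ densityMeasure π := by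
    rw [heq]
    exact withDensity_absolutelyContinuous _ _
  have hrn : (densityMeasure ρ).rnDeriv (densityMeasure π) =ᵐ[densityMeasure π]
      fun x => ENNReal.ofReal (ρ x / π x) := by
    rw [heq]
    exact Measure.rnDeriv_withDensity _
      (hρc.div hπc fun x => (hπ.pos x).ne').measurable.ennreal_ofReal
  rw [InformationTheory.klDiv_eq_lintegral_klFun_of_ac hac]
  have h1 : ∫⁻ x, ENNReal.ofReal (InformationTheory.klFun
      ((densityMeasure ρ).rnDeriv (densityMeasure π) x).toReal) ∂(densityMeasure π) =
      ∫⁻ x, ENNReal.ofReal (InformationTheory.klFun (ρ x / π x)) ∂(densityMeasure π) := by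
    refine lintegral_congr_ae ?_
    filter_upwards [hrn] with x hx
    rw [hx, ENNReal.toReal_ofReal (div_pos (hρ.pos x) (hπ.pos x)).le]
  rw [h1, lintegral_densityMeasure hπc]
  exact lintegral_congr fun x => (ENNReal.ofReal_mul (hπ.pos x).le).symm

theorem integrable_klFun_of_klDiv_lt_top {ρ π : EuclideanSpace ℝ (Fin d) → ℝ}
    (hρ : IsSmoothDensity ρ) (hπ : IsSmoothDensity π)
    (hkl : InformationTheory.klDiv (densityMeasure ρ) (densityMeasure π) < ⊤) :
    Integrable (fun x => π x * InformationTheory.klFun (ρ x / π x)) ∧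
      ENNReal.ofReal (∫ x, π x * InformationTheory.klFun (ρ x / π x)) =
        InformationTheory.klDiv (densityMeasure ρ) (densityMeasure π) := by
  have h0 : 0 ≤ᵐ[volume] fun x => π x * InformationTheory.klFun (ρ x / π x) :=
    ae_of_all _ fun x => mul_nonneg (hπ.pos x).le
      (InformationTheory.klFun_nonneg (div_pos (hρ.pos x) (hπ.pos x)).le)
  have hi : Integrable (fun x => π x * InformationTheory.klFun (ρ x / π x)) := by
    refine ⟨?_, ?_⟩
    · exact (hπ.contDiff.continuous.mul (InformationTheory.continuous_klFun.comp
        (hρ.contDiff.continuous.div hπ.contDiff.continuous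
          fun x => (hπ.pos x).ne'))).aestronglyMeasurable
    · rw [hasFiniteIntegral_iff_ofReal h0, ← klDiv_densityMeasure hρ hπ]
      exact hkl
  exact ⟨hi, by rw [ofReal_integral_eq_lintegral_ofReal hi h0, klDiv_densityMeasure hρ hπ]⟩

variable {H : Type*} [NormedAddCommGroup H] [InnerProductSpace ℝ H]
  [CompleteSpace H] [RKHS ℝ H (EuclideanSpace ℝ (Fin d)) ℝ]

theorem integrable_inner_of_memLp {X V : Type*} [MeasurableSpace X] {μ : Measure X}
    [NormedAddCommGroup V] [InnerProductSpace ℝ V] {f g : X → V} (hf : MemLp f 2 μ)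
    (hg : MemLp g 2 μ) : Integrable (fun x => ⟪f x, g x⟫) μ := by
  refine (L2.integrable_inner (𝕜 := ℝ) (hf.toLp f) (hg.toLp g)).congr ?_
  filter_upwards [hf.coeFn_toLp, hg.coeFn_toLp] with x h1 h2
  rw [h1, h2]

/-! ### Entropy dissipation along the flow -/

/-- The Fisher information splits as `(1-ν) ⟪s, v⟫ + ⟪s, w⟫`, and the second term, as well as the
squared norm of `w`, is bounded through the preimage norm. -/
theorem fisherInfo_le_dissipation_add
    (hk : Continuous (Function.uncurry (scalarKernel (d := d) H)))
    {ρ π : EuclideanSpace ℝ (Fin d) → ℝ} {ν : ℝ} (hν₀ : 0 < ν) (hν₁ : ν < 1)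
    (hμ : Integrable (fun x : EuclideanSpace ℝ (Fin d) => scalarKernel H x x) (densityMeasure ρ))
    (hs : MemLp (score ρ π) 2 (densityMeasure ρ)) {γ : ℝ} (hγ : γ ∈ Ioc (0 : ℝ) (1 / 2))
    (hI : preimageNorm H ρ π γ < ⊤) :
    0 ≤ ∫ x, ⟪score ρ π x, rsvgfField H ν ρ π x⟫ ∂(densityMeasure ρ) ∧
    fisherInfo ρ π ≤ ENNReal.ofReal
        ((1 - ν) * ∫ x, ⟪score ρ π x, rsvgfField H ν ρ π x⟫ ∂(densityMeasure ρ)) +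
      ENNReal.ofReal (ν ^ (2 * γ) * (1 - ν) ^ (-(2 * γ))) * preimageNorm H ρ π γ ^ 2 ∧
    ∫⁻ x, ENNReal.ofReal (‖score ρ π x - (1 - ν) • rsvgfField H ν ρ π x‖ ^ 2)
      ∂(densityMeasure ρ) ≤
      ENNReal.ofReal (ν ^ (2 * γ) * (1 - ν) ^ (-(2 * γ))) * preimageNorm H ρ π γ ^ 2 := by
  obtain ⟨h1, h2, h3⟩ := residual_estimates hk hν₀ hν₁ hμ hs hγ hI
  have hv : MemLp (rsvgfField H ν ρ π) 2 (densityMeasure ρ) := memLp_rsvgfField hk hμ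
  have hw : MemLp (fun x => score ρ π x - (1 - ν) • rsvgfField H ν ρ π x) 2 (densityMeasure ρ) :=
    hs.sub (hv.const_smul (1 - ν))
  have hsv : Integrable (fun x => ⟪score ρ π x, rsvgfField H ν ρ π x⟫) (densityMeasure ρ) :=
    integrable_inner_of_memLp hs hv
  have hsw : Integrable (fun x => ⟪score ρ π x,
      score ρ π x - (1 - ν) • rsvgfField H ν ρ π x⟫) (densityMeasure ρ) :=
    integrable_inner_of_memLp hs hw
  refine ⟨h1, ?_, ?_⟩
  · have hss : Integrable (fun x => ‖score ρ π x‖ ^ 2) (densityMeasure ρ) :=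
      (memLp_two_iff_integrable_sq_norm hs.1).1 hs
    have e1 : fisherInfo ρ π = ENNReal.ofReal (∫ x, ‖score ρ π x‖ ^ 2 ∂(densityMeasure ρ)) := by
      rw [fisherInfo, ofReal_integral_eq_lintegral_ofReal hss (ae_of_all _ fun x => by positivity)]
      exact lintegral_congr fun x => by rw [ENNReal.ofReal_pow (norm_nonneg _), ofReal_norm]
    have e2 : ∫ x, ‖score ρ π x‖ ^ 2 ∂(densityMeasure ρ) =
        (1 - ν) * (∫ x, ⟪score ρ π x, rsvgfField H ν ρ π x⟫ ∂(densityMeasure ρ)) +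
        ∫ x, ⟪score ρ π x, score ρ π x - (1 - ν) • rsvgfField H ν ρ π x⟫
          ∂(densityMeasure ρ) := by
      rw [← integral_const_mul, ← integral_add (hsv.const_mul _) hsw]
      refine integral_congr_ae (ae_of_all _ fun x => ?_)
      simp only
      rw [inner_sub_right, real_inner_smul_right, real_inner_self_eq_norm_sq]
      ring
    rw [e1, e2]
    exact ENNReal.ofReal_add_le.trans (by gcongr)
  · have hww := (memLp_two_iff_integrable_sq_norm hw.1).1 hw
    rw [← ofReal_integral_eq_lintegral_ofReal hww (ae_of_all _ fun x => by positivity)]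
    exact (ENNReal.ofReal_le_ofReal h2).trans h3

variable {ν : ℝ} {π : EuclideanSpace ℝ (Fin d) → ℝ} {ρ : ℝ → EuclideanSpace ℝ (Fin d) → ℝ}

theorem IsRSVGF.continuousOn_fderiv (hρ : IsRSVGF H ν π ρ) :
    ContinuousOn (fun p : ℝ × EuclideanSpace ℝ (Fin d) => fderiv ℝ (ρ p.1) p.2)
      (Ici 0 ×ˢ univ) := by
  have h := (InnerProductSpace.toDual ℝ (EuclideanSpace ℝ (Fin d))).continuous.comp_continuousOn
    hρ.continuous_gradient
  refine h.congr fun p _ => ?_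
  simp [gradient]

theorem IsRSVGF.aestronglyMeasurable_field (hρ : IsRSVGF H ν π ρ) (T : ℝ) :
    AEStronglyMeasurable (fun p : ℝ × EuclideanSpace ℝ (Fin d) => rsvgfField H ν (ρ p.1) π p.2)
      ((volume.restrict (Ioc 0 T)).prod volume) := by
  refine hρ.field_measurable.mono_measure ?_
  rw [prod_restrict_univ, prod_restrict_univ]
  exact Measure.restrict_mono (Set.prod_mono Ioc_subset_Ioi_self le_rfl) le_rfl

theorem IsRSVGF.aestronglyMeasurable_flux (hρ : IsRSVGF H ν π ρ) (T : ℝ) :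
    AEStronglyMeasurable (fun p : ℝ × EuclideanSpace ℝ (Fin d) =>
      ρ p.1 p.2 • rsvgfField H ν (ρ p.1) π p.2) ((volume.restrict (Ioc 0 T)).prod volume) := by
  have h1 : AEStronglyMeasurable (Function.uncurry ρ) ((volume.restrict (Ioc 0 T)).prod volume) :=
    aestronglyMeasurable_of_continuousOn_Ici hρ.continuous measurableSet_Ioc fun t ht => ht.1.le
  exact h1.smul (hρ.aestronglyMeasurable_field T)

/-- A solution of the regularized Stein variational gradient flow solves the continuity equation
with flux `ρ_t v_t`. -/
theorem IsRSVGF.isContinuityFlow (hρ : IsRSVGF H ν π ρ) :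
    IsContinuityFlow volume ρ fun t x => ρ t x • rsvgfField H ν (ρ t) π x where
  continuous := hρ.continuous
  integrable t ht := (hρ.density t ht).integrable
  flux_integrable T := by
    rcases le_or_gt T 0 with hT | hT
    · rw [Ioc_eq_empty (not_lt.2 hT), Measure.restrict_empty, Measure.zero_prod]
      exact integrable_zero_measure
    refine ⟨hρ.aestronglyMeasurable_flux T, ?_⟩
    have hm : AEStronglyMeasurable (Function.uncurry fun t x => ρ t x • rsvgfField H ν (ρ t) π x)
        ((volume.restrict (Ioc 0 T)).prod volume) := hρ.aestronglyMeasurable_flux T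
    rw [hasFiniteIntegral_iff_enorm, lintegral_prod _ hm.enorm]
    refine lt_of_eq_of_lt ?_ (hρ.flux_integrable T hT)
    refine setLIntegral_congr_fun measurableSet_Ioc fun t ht => ?_
    have hd := hρ.density t ht.1.le
    rw [lintegral_densityMeasure hd.contDiff.continuous]
    refine lintegral_congr fun x => ?_
    rw [Function.uncurry, enorm_smul, Real.enorm_of_nonneg (hd.pos x).le]
  weak_equation φ hφ hφc := by
    refine Eq.trans ?_ (hρ.weak_equation φ hφ hφc)
    congr 1
    · refine setIntegral_congr_fun measurableSet_Ioi fun t ht => ?_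
      have hd := hρ.density t (le_of_lt ht)
      rw [integral_densityMeasure hd.contDiff.continuous hd.pos]
      refine integral_congr_ae (ae_of_all _ fun x => ?_)
      simp only
      rw [inner_gradient_eq_fderiv, map_smul, smul_eq_mul, mul_sub]
    · have hd := hρ.density 0 le_rfl
      rw [integral_densityMeasure hd.contDiff.continuous hd.pos]

/-- The pointwise lower bound of the dissipation density by the squared residual. -/
theorem neg_norm_sq_le_inner {V : Type*} [NormedAddCommGroup V] [InnerProductSpace ℝ V]
    (hν₁ : ν < 1) (s v : V) : -(‖s - (1 - ν) • v‖ ^ 2 / (4 * (1 - ν))) ≤ ⟪s, v⟫ := by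
  have h0 : 0 < 1 - ν := by linarith
  have h1 := sq_nonneg (‖s + (1 - ν) • v‖)
  have h2 : ‖s + (1 - ν) • v‖ ^ 2 = ‖s - (1 - ν) • v‖ ^ 2 + 4 * (1 - ν) * ⟪s, v⟫ := by
    rw [norm_add_sq_real, norm_sub_sq_real, real_inner_smul_right]
    ring
  rw [neg_le_iff_add_nonneg, ← mul_le_mul_iff_right₀ (show 0 < 4 * (1 - ν) by positivity)]
  have h3 : 4 * (1 - ν) * (⟪s, v⟫ + ‖s - (1 - ν) • v‖ ^ 2 / (4 * (1 - ν))) =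
      ‖s - (1 - ν) • v‖ ^ 2 + 4 * (1 - ν) * ⟪s, v⟫ := by
    field_simp
    ring
  rw [h3, ← h2, mul_zero]
  exact h1

/-- The bound of the integrated Fisher information on a bounded time interval, when its right-hand
side is finite. -/
theorem IsRSVGF.lintegral_fisherInfo_le (hk : IsContinuousSPDKernel (scalarKernel (d := d) H))
    (hν₀ : 0 < ν) (hν₁ : ν < 1) (hπ : IsSmoothDensity π) (hρ : IsRSVGF H ν π ρ)
    {γ : ℝ → ℝ} (hγ : ∀ t, 0 < t → γ t ∈ Ioc (0 : ℝ) (1 / 2))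
    (hI : ∀ t, 0 < t → preimageNorm H (ρ t) π (γ t) < ⊤)
    (hkl : InformationTheory.klDiv (densityMeasure (ρ 0)) (densityMeasure π) < ⊤)
    (hfin : ∫⁻ t in Ioi (0 : ℝ), ENNReal.ofReal (ν ^ (2 * γ t) * (1 - ν) ^ (-(2 * γ t))) *
            preimageNorm H (ρ t) π (γ t) ^ 2 < ⊤) {T : ℝ} (hT : 0 ≤ T) :
    ∫⁻ t in Ioc 0 T, fisherInfo (ρ t) π ≤
      ENNReal.ofReal (1 - ν) * InformationTheory.klDiv (densityMeasure (ρ 0)) (densityMeasure π)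
        + ∫⁻ t in Ioi (0 : ℝ), ENNReal.ofReal (ν ^ (2 * γ t) * (1 - ν) ^ (-(2 * γ t))) *
            preimageNorm H (ρ t) π (γ t) ^ 2 := by
  set a : ℝ → ℝ≥0∞ := fun t => ENNReal.ofReal (ν ^ (2 * γ t) * (1 - ν) ^ (-(2 * γ t))) *
            preimageNorm H (ρ t) π (γ t) ^ 2 with ha
  have h0 : 0 < 1 - ν := by linarith
  set κ := (volume.restrict (Ioc 0 T)).prod (volume : Measure (EuclideanSpace ℝ (Fin d))) with hκ
  set v : ℝ → EuclideanSpace ℝ (Fin d) → EuclideanSpace ℝ (Fin d) :=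
    fun t => rsvgfField H ν (ρ t) π with hv
  set s : ℝ → EuclideanSpace ℝ (Fin d) → EuclideanSpace ℝ (Fin d) :=
    fun t => score (ρ t) π with hs
  have hfix := fun t (ht : 0 < t) => fisherInfo_le_dissipation_add hk.continuous hν₀ hν₁
    (hρ.kernel_integrable t ht) (hρ.score_memLp t ht) (hγ t ht) (hI t ht)
  have hpos : ∀ t, 0 ≤ t → ∀ x, 0 < ρ t x := fun t ht => (hρ.density t ht).pos
  have hd : ∀ t, 0 ≤ t → ContDiff ℝ 1 (ρ t) := fun t ht =>
    (hρ.density t ht).contDiff.of_le one_le_two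
  have hπ1 : ContDiff ℝ 1 π := hπ.contDiff.of_le one_le_two
  have hρm : AEStronglyMeasurable (fun p : ℝ × EuclideanSpace ℝ (Fin d) => ρ p.1 p.2) κ :=
    aestronglyMeasurable_of_continuousOn_Ici hρ.continuous measurableSet_Ioc fun t ht => ht.1.le
  have hvm : AEStronglyMeasurable (fun p : ℝ × EuclideanSpace ℝ (Fin d) => v p.1 p.2) κ :=
    hρ.aestronglyMeasurable_field T
  have hsm : AEStronglyMeasurable (fun p : ℝ × EuclideanSpace ℝ (Fin d) => s p.1 p.2) κ :=
    aestronglyMeasurable_of_continuousOn_Ici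
      ((InnerProductSpace.toDual ℝ (EuclideanSpace ℝ (Fin d))).symm.continuous.comp_continuousOn
        (continuousOn_fderiv_log_div hρ.continuous hpos hd hρ.continuousOn_fderiv hπ1 hπ.pos))
      measurableSet_Ioc fun t ht => ht.1.le
  -- The squared residual, weighted as in the lower bound `neg_norm_sq_le_inner`.
  set W : ℝ × EuclideanSpace ℝ (Fin d) → ℝ := fun p =>
    (4 * (1 - ν))⁻¹ * (ρ p.1 p.2 * ‖s p.1 p.2 - (1 - ν) • v p.1 p.2‖ ^ 2) with hW
  have hWm : AEStronglyMeasurable (fun p : ℝ × EuclideanSpace ℝ (Fin d) =>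
      ρ p.1 p.2 * ‖s p.1 p.2 - (1 - ν) • v p.1 p.2‖ ^ 2) κ :=
    hρm.mul ((hsm.sub (hvm.const_smul (1 - ν))).norm.pow 2)
  have hmem : ∀ᵐ p ∂κ, p ∈ Ioc 0 T ×ˢ (univ : Set (EuclideanSpace ℝ (Fin d))) := by
    rw [hκ, prod_restrict_univ]
    exact ae_restrict_mem (measurableSet_Ioc.prod MeasurableSet.univ)
  have hWi : Integrable W κ := by
    refine Integrable.const_mul ⟨hWm, ?_⟩ _
    rw [hasFiniteIntegral_iff_ofReal (by
      filter_upwards [hmem] with p hp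
      exact mul_nonneg (hpos p.1 hp.1.1.le p.2).le (by positivity)),
      lintegral_prod _ hWm.aemeasurable.ennreal_ofReal]
    refine lt_of_le_of_lt ?_ hfin
    refine le_trans ?_ (lintegral_mono_set (f := a)
      (show Ioc 0 T ⊆ Ioi 0 from Ioc_subset_Ioi_self))
    refine setLIntegral_mono' measurableSet_Ioc fun t ht => ?_
    refine le_trans (le_of_eq ?_) (hfix t ht.1).2.2
    rw [lintegral_densityMeasure (hd t ht.1.le).continuous]
    exact lintegral_congr fun x => ENNReal.ofReal_mul (hpos t ht.1.le x).le
  have hGeq : ∀ (t : ℝ) (x : EuclideanSpace ℝ (Fin d)),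
      fderiv ℝ (fun y => Real.log (ρ t y / π y)) x (ρ t x • v t x) =
        ρ t x * ⟪s t x, v t x⟫ := fun t x => by
    rw [map_smul, smul_eq_mul, ← inner_gradient_eq_fderiv]
    rfl
  obtain ⟨hklint, hkleq⟩ := integrable_klFun_of_klDiv_lt_top (hρ.density 0 le_rfl) hπ hkl
  obtain ⟨hGi, hGle⟩ := hρ.isContinuityFlow.dissipation_le hpos hd hρ.continuousOn_fderiv hπ1
    hπ.pos hklint hT hWi (by
      filter_upwards [hmem] with p hp
      have hp0 := hpos p.1 hp.1.1.le p.2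
      refine ⟨by positivity, ?_⟩
      rw [hGeq]
      have h1 := mul_le_mul_of_nonneg_left
        (neg_norm_sq_le_inner hν₁ (s p.1 p.2) (v p.1 p.2)) hp0.le
      refine le_trans (le_of_eq ?_) h1
      simp only [hW]
      field_simp)
  have hGfun : (fun p : ℝ × EuclideanSpace ℝ (Fin d) => fderiv ℝ
      (fun y => Real.log (ρ p.1 y / π y)) p.2 (ρ p.1 p.2 • rsvgfField H ν (ρ p.1) π p.2)) =
      fun p => ρ p.1 p.2 * ⟪s p.1 p.2, v p.1 p.2⟫ := funext fun p => hGeq p.1 p.2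
  rw [hGfun] at hGi hGle
  rw [integral_prod _ hGi] at hGle
  have hDi := hGi.integral_prod_left
  have hDeq : ∀ t ∈ Ioc 0 T, ∫ x, ⟪s t x, v t x⟫ ∂(densityMeasure (ρ t)) =
      ∫ x, ρ t x * ⟪s t x, v t x⟫ := fun t ht =>
    integral_densityMeasure (hd t ht.1.le).continuous (hpos t ht.1.le) _
  calc ∫⁻ t in Ioc 0 T, fisherInfo (ρ t) π
      ≤ ∫⁻ t in Ioc 0 T, (ENNReal.ofReal ((1 - ν) * ∫ x, ρ t x * ⟪s t x, v t x⟫) + a t) := by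
        refine setLIntegral_mono' measurableSet_Ioc fun t ht => ?_
        rw [← hDeq t ht]
        exact (hfix t ht.1).2.1
    _ = (∫⁻ t in Ioc 0 T, ENNReal.ofReal ((1 - ν) * ∫ x, ρ t x * ⟪s t x, v t x⟫)) +
        ∫⁻ t in Ioc 0 T, a t :=
        -- Only the dissipation is known to be measurable in time, not `a`.
        lintegral_add_left' (hDi.const_mul _).1.aemeasurable.ennreal_ofReal _
    _ ≤ _ := by
        refine add_le_add ?_ (lintegral_mono_set Ioc_subset_Ioi_self)
        rw [← ofReal_integral_eq_lintegral_ofReal (hDi.const_mul _), integral_const_mul,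
          ENNReal.ofReal_mul h0.le, ← hkleq]
        · gcongr
        · filter_upwards [ae_restrict_mem measurableSet_Ioc] with t ht
          rw [← hDeq t ht]
          exact mul_nonneg h0.le (hfix t ht.1).1

end Densities

/-! ### Convexity of the Fisher information -/

section Convexity

variable {d : ℕ} {ρ : ℝ → EuclideanSpace ℝ (Fin d) → ℝ} {π : EuclideanSpace ℝ (Fin d) → ℝ}

theorem continuousOn_slice {X Y : Type*} [TopologicalSpace X] [TopologicalSpace Y] {f : ℝ × X → Y}
    (hf : ContinuousOn f (Ici 0 ×ˢ univ)) (x : X) {t : ℝ} (ht : 0 ≤ t) :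
    ContinuousOn (fun s => f (s, x)) (uIcc 0 t) := by
  refine hf.comp (continuous_id.prodMk continuous_const).continuousOn fun s hs => ?_
  rw [uIcc_of_le ht] at hs
  exact ⟨hs.1, mem_univ _⟩

theorem avgDensity_pos (hc : ContinuousOn (Function.uncurry ρ) (Ici 0 ×ˢ univ))
    (hpos : ∀ t, 0 ≤ t → ∀ x, 0 < ρ t x) {t : ℝ} (ht : 0 < t) (x : EuclideanSpace ℝ (Fin d)) :
    0 < avgDensity ρ t x :=
  mul_pos (inv_pos.2 ht) (intervalIntegral.intervalIntegral_pos_of_pos_on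
    (continuousOn_slice hc x ht.le).intervalIntegrable (fun s hs => hpos s hs.1.le x) ht)

theorem hasFDerivAt_avgDensity (hc : ContinuousOn (Function.uncurry ρ) (Ici 0 ×ˢ univ))
    (hd : ∀ t, 0 ≤ t → ContDiff ℝ 1 (ρ t))
    (hD : ContinuousOn (fun p : ℝ × EuclideanSpace ℝ (Fin d) => fderiv ℝ (ρ p.1) p.2)
      (Ici 0 ×ˢ univ)) {t : ℝ} (ht : 0 < t) (x : EuclideanSpace ℝ (Fin d)) :
    HasFDerivAt (avgDensity ρ t) (t⁻¹ • ∫ s in (0 : ℝ)..t, fderiv ℝ (ρ s) x) x := by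
  obtain ⟨C, hC⟩ := (isCompact_Icc.prod (isCompact_closedBall x 1)).exists_bound_of_continuousOn
    (hD.mono (Set.prod_mono (show Icc 0 t ⊆ Ici 0 from Icc_subset_Ici_self)
      (subset_univ (Metric.closedBall x 1))))
  refine HasFDerivAt.const_mul ?_ t⁻¹
  refine (intervalIntegral.hasFDerivAt_integral_of_dominated_of_fderiv_le
    (F := fun y s => ρ s y) (F' := fun y s => fderiv ℝ (ρ s) y) (bound := fun _ => C)
    (Metric.ball_mem_nhds x one_pos) ?_ ?_ ?_ ?_ ?_ ?_)
  · refine Eventually.of_forall fun y => ?_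
    exact (intervalIntegrable_iff.1
      (continuousOn_slice hc y ht.le).intervalIntegrable).aestronglyMeasurable
  · exact (continuousOn_slice hc x ht.le).intervalIntegrable
  · exact (intervalIntegrable_iff.1
      (continuousOn_slice hD x ht.le).intervalIntegrable).aestronglyMeasurable
  · refine ae_of_all _ fun s hs y hy => ?_
    rw [uIoc_of_le ht.le] at hs
    exact hC (s, y) ⟨⟨hs.1.le, hs.2⟩, Metric.ball_subset_closedBall hy⟩
  · exact intervalIntegrable_const
  · refine ae_of_all _ fun s hs y hy => ?_
    rw [uIoc_of_le ht.le] at hs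
    exact ((hd s hs.1.le).differentiable one_ne_zero).differentiableAt.hasFDerivAt

/-- The integrand of the Fisher information of the average is at most the average of the
integrands: with `R` and `σ` the averaged density and its score, `R σ` is the average of
`ρ_s ∇ log (ρ_s / π)`, and it remains to pair with `σ` and to use `2 ⟪a, σ⟫ ≤ ‖a‖² + ‖σ‖²`. -/
theorem avgDensity_mul_score_sq_le (hc : ContinuousOn (Function.uncurry ρ) (Ici 0 ×ˢ univ))
    (hpos : ∀ t, 0 ≤ t → ∀ x, 0 < ρ t x) (hd : ∀ t, 0 ≤ t → ContDiff ℝ 1 (ρ t))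
    (hD : ContinuousOn (fun p : ℝ × EuclideanSpace ℝ (Fin d) => fderiv ℝ (ρ p.1) p.2)
      (Ici 0 ×ˢ univ)) (hπ : ContDiff ℝ 1 π) (hπpos : ∀ x, 0 < π x) {t : ℝ} (ht : 0 < t)
    (x : EuclideanSpace ℝ (Fin d))
    (hint : IntervalIntegrable (fun s => ρ s x * ‖score (ρ s) π x‖ ^ 2) volume 0 t) :
    avgDensity ρ t x * ‖score (avgDensity ρ t) π x‖ ^ 2 ≤
      t⁻¹ * ∫ s in (0 : ℝ)..t, ρ s x * ‖score (ρ s) π x‖ ^ 2 := by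
  set R := avgDensity ρ t with hR
  set σ := score R π x with hσ
  have hRpos : 0 < R x := avgDensity_pos hc hpos ht x
  have hRd := hasFDerivAt_avgDensity hc hd hD ht x
  have hπx := (hπ.differentiable one_ne_zero).differentiableAt (x := x)
  have hRint : R x = t⁻¹ * ∫ s in (0 : ℝ)..t, ρ s x := rfl
  have hDi : IntervalIntegrable (fun s => fderiv ℝ (ρ s) x) volume 0 t :=
    (continuousOn_slice hD x ht.le).intervalIntegrable
  have hρi : IntervalIntegrable (fun s => ρ s x) volume 0 t :=
    (continuousOn_slice hc x ht.le).intervalIntegrable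
  have hDσ : IntervalIntegrable (fun s => fderiv ℝ (ρ s) x σ) volume 0 t :=
    ⟨hDi.1.apply_continuousLinearMap σ, hDi.2.apply_continuousLinearMap σ⟩
  have h1 : R x * ‖σ‖ ^ 2 = t⁻¹ * ∫ s in (0 : ℝ)..t,
      (fderiv ℝ (ρ s) x σ - ρ s x * ((π x)⁻¹ * fderiv ℝ π x σ)) := by
    have e1 : ‖σ‖ ^ 2 = (R x)⁻¹ * fderiv ℝ R x σ - (π x)⁻¹ * fderiv ℝ π x σ := by
      rw [← real_inner_self_eq_norm_sq, hσ, score, inner_gradient_eq_fderiv,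
        (hasFDerivAt_log_div hRd.differentiableAt hπx hRpos (hπpos x)).fderiv,
        sub_apply, smul_apply, smul_apply, smul_eq_mul, smul_eq_mul]
    have e2 : fderiv ℝ R x σ = t⁻¹ * ∫ s in (0 : ℝ)..t, fderiv ℝ (ρ s) x σ := by
      rw [hRd.fderiv, smul_apply, ContinuousLinearMap.intervalIntegral_apply hDi, smul_eq_mul]
    rw [intervalIntegral.integral_sub hDσ (hρi.mul_const _), intervalIntegral.integral_mul_const,
      e1, mul_sub, mul_sub, ← e2, ← mul_assoc t⁻¹, ← hRint, mul_inv_cancel_left₀ hRpos.ne']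
  have h2 : ∫ s in (0 : ℝ)..t, (fderiv ℝ (ρ s) x σ - ρ s x * ((π x)⁻¹ * fderiv ℝ π x σ)) ≤
      ∫ s in (0 : ℝ)..t, (2⁻¹ * (ρ s x * ‖score (ρ s) π x‖ ^ 2) + ρ s x * (2⁻¹ * ‖σ‖ ^ 2)) := by
    refine intervalIntegral.integral_mono_on ht.le (hDσ.sub (hρi.mul_const _))
      ((hint.const_mul _).add (hρi.mul_const _)) fun s hs => ?_
    have hs0 := hpos s hs.1 x
    have e3 : fderiv ℝ (ρ s) x σ - ρ s x * ((π x)⁻¹ * fderiv ℝ π x σ) =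
        ρ s x * ⟪score (ρ s) π x, σ⟫ := by
      rw [score, inner_gradient_eq_fderiv, (hasFDerivAt_log_div
        ((hd s hs.1).differentiable one_ne_zero).differentiableAt hπx hs0 (hπpos x)).fderiv,
        sub_apply, smul_apply, smul_apply, smul_eq_mul, smul_eq_mul, mul_sub,
        mul_inv_cancel_left₀ hs0.ne']
    have e4 : ⟪score (ρ s) π x, σ⟫ ≤ 2⁻¹ * ‖score (ρ s) π x‖ ^ 2 + 2⁻¹ * ‖σ‖ ^ 2 := by
      have := norm_sub_sq_real (score (ρ s) π x) σ
      nlinarith [sq_nonneg ‖score (ρ s) π x - σ‖]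
    rw [e3]
    refine (mul_le_mul_of_nonneg_left e4 hs0.le).trans (le_of_eq ?_)
    ring
  have h3 := mul_le_mul_of_nonneg_left h2 (inv_pos.2 ht).le
  rw [← h1, intervalIntegral.integral_add (hint.const_mul _) (hρi.mul_const _),
    intervalIntegral.integral_const_mul, intervalIntegral.integral_mul_const, mul_add,
    ← mul_assoc t⁻¹ (∫ s in (0 : ℝ)..t, ρ s x), ← hRint] at h3
  linarith

/-- Convexity of the Fisher information in its first argument, for time averages. -/
theorem fisherInfo_avgDensity_le (hc : ContinuousOn (Function.uncurry ρ) (Ici 0 ×ˢ univ))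
    (hpos : ∀ t, 0 ≤ t → ∀ x, 0 < ρ t x) (hd : ∀ t, 0 ≤ t → ContDiff ℝ 1 (ρ t))
    (hD : ContinuousOn (fun p : ℝ × EuclideanSpace ℝ (Fin d) => fderiv ℝ (ρ p.1) p.2)
      (Ici 0 ×ˢ univ)) (hπ : ContDiff ℝ 1 π) (hπpos : ∀ x, 0 < π x) {t : ℝ} (ht : 0 < t) :
    fisherInfo (avgDensity ρ t) π ≤
      ENNReal.ofReal t⁻¹ * ∫⁻ s in Ioc 0 t, fisherInfo (ρ s) π := by
  have hsc : ContinuousOn (fun p : ℝ × EuclideanSpace ℝ (Fin d) =>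
      ρ p.1 p.2 * ‖score (ρ p.1) π p.2‖ ^ 2) (Ici 0 ×ˢ univ) :=
    hc.mul (((InnerProductSpace.toDual ℝ (EuclideanSpace ℝ (Fin d))).symm.continuous.comp_continuousOn
      (continuousOn_fderiv_log_div hc hpos hd hD hπ hπpos)).norm.pow 2)
  have hRc : Continuous (avgDensity ρ t) := continuous_iff_continuousAt.2 fun x =>
    (hasFDerivAt_avgDensity hc hd hD ht x).continuousAt
  have hsq : ∀ (r : ℝ), 0 < r → ∀ y : EuclideanSpace ℝ (Fin d),
      ENNReal.ofReal r * ‖y‖ₑ ^ 2 = ENNReal.ofReal (r * ‖y‖ ^ 2) := fun r hr y => by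
    rw [ENNReal.ofReal_mul hr.le, ENNReal.ofReal_pow (norm_nonneg _), ofReal_norm]
  have hm : AEMeasurable (Function.uncurry fun (x : EuclideanSpace ℝ (Fin d)) (s : ℝ) =>
      ENNReal.ofReal (ρ s x * ‖score (ρ s) π x‖ ^ 2))
      ((volume : Measure (EuclideanSpace ℝ (Fin d))).prod (volume.restrict (Ioc 0 t))) := by
    have h := (aestronglyMeasurable_of_continuousOn_Ici (μ := volume) hsc
      (measurableSet_Ioc (a := (0 : ℝ)) (b := t)) fun s hs => hs.1.le).aemeasurable.ennreal_ofReal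
    exact h.comp_quasiMeasurePreserving Measure.measurePreserving_swap.quasiMeasurePreserving
  calc fisherInfo (avgDensity ρ t) π
      = ∫⁻ x, ENNReal.ofReal (avgDensity ρ t x * ‖score (avgDensity ρ t) π x‖ ^ 2) := by
        rw [fisherInfo, lintegral_densityMeasure hRc]
        exact lintegral_congr fun x => hsq _ (avgDensity_pos hc hpos ht x) _
    _ ≤ ∫⁻ x, ENNReal.ofReal t⁻¹ *
          ∫⁻ s in Ioc 0 t, ENNReal.ofReal (ρ s x * ‖score (ρ s) π x‖ ^ 2) := by
        refine lintegral_mono fun x => ?_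
        have hi := (continuousOn_slice hsc x ht.le).intervalIntegrable (μ := volume)
        refine (ENNReal.ofReal_le_ofReal
          (avgDensity_mul_score_sq_le hc hpos hd hD hπ hπpos ht x hi)).trans (le_of_eq ?_)
        rw [ENNReal.ofReal_mul (inv_pos.2 ht).le, intervalIntegral.integral_of_le ht.le,
          ofReal_integral_eq_lintegral_ofReal
            ((intervalIntegrable_iff_integrableOn_Ioc_of_le ht.le).1 hi)]
        filter_upwards [ae_restrict_mem measurableSet_Ioc] with s hs
        exact mul_nonneg (hpos s hs.1.le x).le (sq_nonneg _)
    _ = ENNReal.ofReal t⁻¹ * ∫⁻ x,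
          ∫⁻ s in Ioc 0 t, ENNReal.ofReal (ρ s x * ‖score (ρ s) π x‖ ^ 2) :=
        lintegral_const_mul' _ _ ENNReal.ofReal_ne_top
    _ = ENNReal.ofReal t⁻¹ * ∫⁻ s in Ioc 0 t, fisherInfo (ρ s) π := by
        rw [lintegral_lintegral_swap hm]
        congr 1
        refine setLIntegral_congr_fun measurableSet_Ioc fun s hs => ?_
        rw [fisherInfo, lintegral_densityMeasure (hd s hs.1.le).continuous]
        exact lintegral_congr fun x => (hsq _ (hpos s hs.1.le x) _).symm

end Convexity

/-! ### The integrated Fisher information and the time averages -/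

theorem mainTheorem2 {d : ℕ} (H : Type*) [NormedAddCommGroup H] [InnerProductSpace ℝ H]
    [CompleteSpace H] [RKHS ℝ H (EuclideanSpace ℝ (Fin d)) ℝ]
    (hk : IsContinuousSPDKernel (scalarKernel (d := d) H))
    (ν : ℝ) (hν₀ : 0 < ν) (hν₁ : ν < 1)
    (π : EuclideanSpace ℝ (Fin d) → ℝ) (hπ : IsSmoothDensity π)
    (ρ : ℝ → EuclideanSpace ℝ (Fin d) → ℝ) (hρ : IsRSVGF H ν π ρ)
    (γ : ℝ → ℝ) (hγ : ∀ t, 0 < t → γ t ∈ Ioc (0 : ℝ) (1 / 2))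
    (hI : ∀ t, 0 < t → preimageNorm H (ρ t) π (γ t) < ⊤) :
    (∫⁻ t in Ioi (0 : ℝ), fisherInfo (ρ t) π ≤
      ENNReal.ofReal (1 - ν) * InformationTheory.klDiv (densityMeasure (ρ 0)) (densityMeasure π)
        + ∫⁻ t in Ioi (0 : ℝ), ENNReal.ofReal (ν ^ (2 * γ t) * (1 - ν) ^ (-(2 * γ t))) *
            preimageNorm H (ρ t) π (γ t) ^ 2) ∧
    (InformationTheory.klDiv (densityMeasure (ρ 0)) (densityMeasure π) < ⊤ →
      ∫⁻ t in Ioi (0 : ℝ), ENNReal.ofReal (ν ^ (2 * γ t) * (1 - ν) ^ (-(2 * γ t))) *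
          preimageNorm H (ρ t) π (γ t) ^ 2 < ⊤ →
      Tendsto (fun t => fisherInfo (avgDensity ρ t) π) atTop (𝓝 0)) := by
  have h0 : 0 < 1 - ν := by linarith
  have hle : ∫⁻ t in Ioi (0 : ℝ), fisherInfo (ρ t) π ≤
      ENNReal.ofReal (1 - ν) * InformationTheory.klDiv (densityMeasure (ρ 0)) (densityMeasure π)
        + ∫⁻ t in Ioi (0 : ℝ), ENNReal.ofReal (ν ^ (2 * γ t) * (1 - ν) ^ (-(2 * γ t))) *
            preimageNorm H (ρ t) π (γ t) ^ 2 := by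
    rcases eq_top_or_lt_top (InformationTheory.klDiv (densityMeasure (ρ 0)) (densityMeasure π))
      with hkl | hkl
    · rw [hkl, ENNReal.mul_top (ENNReal.ofReal_pos.2 h0).ne', top_add]
      exact le_top
    rcases eq_top_or_lt_top (∫⁻ t in Ioi (0 : ℝ), ENNReal.ofReal (ν ^ (2 * γ t) *
      (1 - ν) ^ (-(2 * γ t))) * preimageNorm H (ρ t) π (γ t) ^ 2) with hfin | hfin
    · rw [hfin, add_top]
      exact le_top
    have hU : ⋃ n : ℕ, Ioc (0 : ℝ) n = Ioi 0 :=
      iUnion_Ioc_eq_Ioi_self_iff.2 fun x _ => exists_nat_ge x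
    rw [← hU, setLIntegral_iUnion_of_directed _ (directed_of_isDirected_le fun m n hmn =>
      Ioc_subset_Ioc_right (by exact_mod_cast hmn)), hU]
    exact iSup_le fun n =>
      hρ.lintegral_fisherInfo_le hk hν₀ hν₁ hπ hγ hI hkl hfin n.cast_nonneg
  refine ⟨hle, fun hkl hfin => ?_⟩
  have htop : ∫⁻ t in Ioi (0 : ℝ), fisherInfo (ρ t) π ≠ ⊤ := (hle.trans_lt
    (ENNReal.add_lt_top.2 ⟨ENNReal.mul_lt_top ENNReal.ofReal_lt_top hkl, hfin⟩)).ne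
  have hlim : Tendsto (fun t : ℝ => ENNReal.ofReal t⁻¹ *
      ∫⁻ t in Ioi (0 : ℝ), fisherInfo (ρ t) π) atTop (𝓝 0) := by
    have h1 : Tendsto (fun t : ℝ => ENNReal.ofReal t⁻¹) atTop (𝓝 0) := by
      simpa [Function.comp_def] using (ENNReal.continuous_ofReal.tendsto 0).comp tendsto_inv_atTop_zero
    simpa using ENNReal.Tendsto.mul_const h1 (Or.inr htop)
  refine tendsto_of_tendsto_of_tendsto_of_le_of_le' tendsto_const_nhds hlim
    (Eventually.of_forall fun _ => bot_le) ?_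
  filter_upwards [eventually_gt_atTop 0] with t ht
  refine (fisherInfo_avgDensity_le hρ.continuous (fun t ht => (hρ.density t ht).pos)
    (fun t ht => (hρ.density t ht).contDiff.of_le one_le_two) hρ.continuousOn_fderiv
    (hπ.contDiff.of_le one_le_two) hπ.pos ht).trans ?_
  gcongr
  exact Ioc_subset_Ioi_self
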